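/- Let $X=[x_1,\dots,x_p]$ be a real $n\times p$ matrix with linearly independent columns. For $y\in\mathbb R^n$ and $\lambda\ge 0$ let $\hat\beta(\lambda)=\hat\beta(\lambda;y)$ be the (unique) minimizer of $\|y-X\beta\|^2+\lambda\sum_{j}|\beta_j|$, let $\mathcal B(\lambda)=\{j:\hat\beta_j(\lambda)\neq 0\}$ be its active set, $\mathrm{Sgn}(\lambda)=(\mathrm{sgn}\,\hat\beta_j(\lambda))_j$ its sign vector, and $\hat\mu_\lambda(y)=X\hat\beta(\lambda)$ the lasso fit. The transition points are $0$ together with those $\lambda>0$ around which $\mathcal B(\cdot)$ is not locally constant. For every $y$ they form a finite sequence $\lambda_0>\lambda_1>\dots>\lambda_K=0$ (all depending on $y$); moreover $\hat\beta(\lambda)=0$ for $\lambda>\lambda_0$, and for $m<K$ the active set and the sign vector are constant on $(\lambda_{m+1},\lambda_m)$, with values denoted $\mathcal B_m$ and $\mathrm{Sgn}_m$. Let $\mathcal W_m=\mathcal B_m\setminus\mathcal B(\lambda_m)$ be the set of predictors that join the active set at $\lambda_m$ and $\mathcal V_m=\mathcal B_m\setminus\mathcal B(\lambda_{m+1})$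 the set of those that leave it at $\lambda_{m+1}$ (for $m=K$ both sets are empty by convention). For a set $B$ of predictors let $X_B$ be the submatrix of the columns in $B$ and $H_B=X_B(X_B^TX_B)^{-1}X_B^T$. For $m$ with $\lambda_m>0$ and $i\in\mathcal W_m$ write $B=\mathcal B(\lambda_m)$, $s$ for the restriction of $\mathrm{Sgn}(\lambda_m)$ to $B$, and $$d_{m,i}=(\mathrm{Sgn}_m)_i-x_i^TX_B(X_B^TX_B)^{-1}s,\qquad S_m=H_B-\frac{X_B(X_B^TX_B)^{-1}s\;x_i^T(I-H_B)}{d_{m,i}},$$ where the second term of $S_m$ is read as $0$ if $d_{m,i}=0$. Then the following hold. 1. (One at a time.) There are finitely many hyperplanes in $\mathbb R^n$, depending only on $X$, such that for every $y$ outside their union, $|\mathcal W_m|\le 1$ and $|\mathcal V_m|\le 1$ for all $m=0,\dots,K$, and $d_{m,i}\ne0$ for all $i\in\mathcal W_m$. 2. (Fit at a transition point.) For every $y$, every $m$ with $\lambda_m>0$ and every $i\in\mathcal W_m$: $\operatorname{tr}(S_m)=|\mathcal B(\lambda_m)|$, and if $d_{m,i}\neq 0$, then $\hat\mu_{\lambda_m}(y)=S_m\,y$.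 3. For $0\le k\le p$ let $\Lambda_k=\{m\le K:|\mathcal B(\lambda_m)|=k\}$ and $m_k^{\mathrm{last}}=\sup\Lambda_k$. If $y\sim N(\mu,\sigma^2I)$ with $\mu\in\mathbb R^n$ and $\sigma^2>0$, then $\Lambda_k\ne\emptyset$ almost surely. 4. (Degrees of freedom.) Suppose that the positive cone condition holds: for every set $A$ of predictors and all signs $s_j\in\{1,-1\}$, the matrix $Z=(s_jx_j)_{j\in A}$ satisfies $(Z^TZ)^{-1}\mathbf 1>0$ in every entry. Then for all $\mu\in\mathbb R^n$, $\sigma^2>0$ and $0\le k\le p$, the fit $\hat\mu_{m_k^{\mathrm{last}}}(y)=\hat\mu_{\lambda_{m_k^{\mathrm{last}}}}(y)$ at the last step with exactly $k$ nonzero predictors is square integrable under $y\sim N(\mu,\sigma^2I)$, and its degrees of freedom are $$df\big(\hat\mu_{m_k^{\mathrm{last}}}\big)=\sum_{i=1}^n\frac{\operatorname{cov}\big((\hat\mu_{m_k^{\mathrm{last}}})_i,\,y_i\big)}{\sigma^2}=k .$$ -/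

import Mathlib

open MeasureTheory ProbabilityTheory
open scoped Matrix NNReal ENNReal

noncomputable section

namespace Lasso

variable {n p : ℕ}

/-- The lasso criterion `‖y - X β‖² + l * ∑ |β_j|` (squared Euclidean norm). -/
def objective (X : Matrix (Fin n) (Fin p) ℝ) (y : Fin n → ℝ) (l : ℝ) (β : Fin p → ℝ) : ℝ :=
  ∑ i, (y i - (X *ᵥ β) i) ^ 2 + l * ∑ j, |β j|

/-- The lasso estimate, a minimizer of the criterion. When the columns of `X` are linearly
independent and `0 ≤ l` there is exactly one minimizer. -/
def coef (X : Matrix (Fin n) (Fin p) ℝ) (y : Fin n → ℝ) (l : ℝ) : Fin p → ℝ :=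
  Classical.epsilon fun β => ∀ b, objective X y l β ≤ objective X y l b

/-- The lasso fit at regularization parameter `l`. -/
def fit (X : Matrix (Fin n) (Fin p) ℝ) (y : Fin n → ℝ) (l : ℝ) : Fin n → ℝ :=
  X *ᵥ coef X y l

/-- The sign vector of the lasso estimate, with entries in `{1, 0, -1}`. -/
def sgn (X : Matrix (Fin n) (Fin p) ℝ) (y : Fin n → ℝ) (l : ℝ) (j : Fin p) : ℝ :=
  Real.sign (coef X y l j)

/-- The active set of the lasso estimate. -/
def active (X : Matrix (Fin n) (Fin p) ℝ) (y : Fin n → ℝ) (l : ℝ) : Finset (Fin p) :=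
  {j | coef X y l j ≠ 0}

/-- The transition points of the path `l ↦ coef X y l`: the positive values of `l` around which
the active set is not locally constant, together with the end point `0`. -/
def transitionPoints (X : Matrix (Fin n) (Fin p) ℝ) (y : Fin n → ℝ) : Set ℝ :=
  {l | l = 0 ∨ 0 < l ∧ ¬ ∀ᶠ l' in nhds l, active X y l' = active X y l}

/-- The index `K` of the last transition point `0`, the transition points being numbered
`knot 0 > knot 1 > ⋯ > knot K = 0`. -/
def lastIndex (X : Matrix (Fin n) (Fin p) ℝ) (y : Fin n → ℝ) : ℕ :=
  (transitionPoints X y).ncard - 1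

open Classical in
/-- The transition points in decreasing order: `knot X y m` is the one with index `m`,
for `m ≤ lastIndex X y` (and `0` for larger `m`). -/
def knot (X : Matrix (Fin n) (Fin p) ℝ) (y : Fin n → ℝ) (m : ℕ) : ℝ :=
  if h : (transitionPoints X y).Finite then
    (h.toFinset.sort (· ≥ ·)).getD m 0
  else 0

/-- The midpoint of the interval `(knot (m + 1), knot m)`. -/
def midpt (X : Matrix (Fin n) (Fin p) ℝ) (y : Fin n → ℝ) (m : ℕ) : ℝ :=
  (knot X y m + knot X y (m + 1)) / 2

/-- The active set on the open interval `(knot (m + 1), knot m)`, on which it is constant;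
it is read off at the midpoint. -/
def intervalActive (X : Matrix (Fin n) (Fin p) ℝ) (y : Fin n → ℝ) (m : ℕ) : Finset (Fin p) :=
  active X y (midpt X y m)

/-- The sign vector on the open interval `(knot (m + 1), knot m)`, on which it is constant;
it is read off at the midpoint. -/
def intervalSgn (X : Matrix (Fin n) (Fin p) ℝ) (y : Fin n → ℝ) (m : ℕ) : Fin p → ℝ :=
  sgn X y (midpt X y m)

/-- The predictors that join the active set at `knot m`: their coefficient is zero at `knot m`
and nonzero on `(knot (m + 1), knot m)`. -/
def joining (X : Matrix (Fin n) (Fin p) ℝ) (y : Fin n → ℝ) (m : ℕ) : Finset (Fin p) :=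
  intervalActive X y m \ active X y (knot X y m)

/-- The predictors that are deleted from the active set at `knot (m + 1)`: their coefficient is
nonzero on `(knot (m + 1), knot m)` and zero at `knot (m + 1)`. -/
def leaving (X : Matrix (Fin n) (Fin p) ℝ) (y : Fin n → ℝ) (m : ℕ) : Finset (Fin p) :=
  intervalActive X y m \ active X y (knot X y (m + 1))

/-- The submatrix formed by the columns of `X` with index in `A`. -/
def cols (X : Matrix (Fin n) (Fin p) ℝ) (A : Finset (Fin p)) : Matrix (Fin n) A ℝ :=
  X.submatrix id Subtype.val

/-- The orthogonal projection matrix onto the span of the columns with index in `A`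
(for linearly independent columns). -/
def hat (X : Matrix (Fin n) (Fin p) ℝ) (A : Finset (Fin p)) : Matrix (Fin n) (Fin n) ℝ :=
  cols X A * ((cols X A)ᵀ * cols X A)⁻¹ * (cols X A)ᵀ

/-- The vector `X_B (X_Bᵀ X_B)⁻¹ s_B`, with `B` and `s` the active set and the sign vector
at `knot m`. -/
def stepDir (X : Matrix (Fin n) (Fin p) ℝ) (y : Fin n → ℝ) (m : ℕ) : Fin n → ℝ :=
  cols X (active X y (knot X y m)) *ᵥ
    (((cols X (active X y (knot X y m)))ᵀ * cols X (active X y (knot X y m)))⁻¹ *ᵥ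
      fun j => sgn X y (knot X y m) j)

/-- The scalar `Sgn_i - x_iᵀ X_B (X_Bᵀ X_B)⁻¹ s_B`, where `Sgn_i` is the sign with which the
predictor `i` joins the active set at `knot m`. -/
def stepDenom (X : Matrix (Fin n) (Fin p) ℝ) (y : Fin n → ℝ) (m : ℕ) (i : Fin p) : ℝ :=
  intervalSgn X y m i - X.col i ⬝ᵥ stepDir X y m

/-- The matrix
`S_m = H_B - X_B (X_Bᵀ X_B)⁻¹ s_B x_iᵀ (I - H_B) / (Sgn_i - x_iᵀ X_B (X_Bᵀ X_B)⁻¹ s_B)`. -/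
def stepMatrix (X : Matrix (Fin n) (Fin p) ℝ) (y : Fin n → ℝ) (m : ℕ) (i : Fin p) :
    Matrix (Fin n) (Fin n) ℝ :=
  hat X (active X y (knot X y m)) -
    (1 / stepDenom X y m i) •
      Matrix.vecMulVec (stepDir X y m) (X.col i ᵥ* (1 - hat X (active X y (knot X y m))))

/-- The steps `m` at which the fit has exactly `k` nonzero coefficients. -/
def stepsWith (X : Matrix (Fin n) (Fin p) ℝ) (y : Fin n → ℝ) (k : ℕ) : Set ℕ :=
  {m | m ≤ lastIndex X y ∧ (active X y (knot X y m)).card = k}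

/-- The last step at which the fit has exactly `k` nonzero coefficients. -/
def lastStep (X : Matrix (Fin n) (Fin p) ℝ) (y : Fin n → ℝ) (k : ℕ) : ℕ :=
  sSup (stepsWith X y k)

/-- The lasso fit at the last step with exactly `k` nonzero coefficients. -/
def lastFit (X : Matrix (Fin n) (Fin p) ℝ) (k : ℕ) (y : Fin n → ℝ) : Fin n → ℝ :=
  fit X y (knot X y (lastStep X y k))

/-- The positive cone condition: for every set `A` of predictors and every choice of signs,
the matrix `Z` with columns `s_j x_j`, `j ∈ A`, satisfies `(Zᵀ Z)⁻¹ 1 > 0` entrywise. -/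
def PositiveCone (X : Matrix (Fin n) (Fin p) ℝ) : Prop :=
  ∀ (A : Finset (Fin p)) (s : Fin p → ℝ), (∀ j, s j = 1 ∨ s j = -1) →
    ∀ i : A,
      0 < (((cols (X * Matrix.diagonal s) A)ᵀ * cols (X * Matrix.diagonal s) A)⁻¹ *ᵥ 1) i

/-- The law `N(μ, v I)` on `ℝⁿ`. -/
def normalLaw (μ : Fin n → ℝ) (v : ℝ≥0) : Measure (Fin n → ℝ) :=
  Measure.pi fun i => gaussianReal (μ i) v

/-- The degrees of freedom `∑ cov(δ_i(y), y_i) / v` of a fitting procedure `δ`,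
where `y ∼ N(μ, v I)`. -/
def df (μ : Fin n → ℝ) (v : ℝ≥0) (δ : (Fin n → ℝ) → Fin n → ℝ) : ℝ :=
  ∑ i, cov[fun y => δ y i, fun y => y i; normalLaw μ v] / (v : ℝ)

end Lasso

end

/-!
The lasso estimate is characterized by the Karush–Kuhn–Tucker conditions: the correlations
`2 x_jᵀ (y - X β)` are bounded by `l` in absolute value, with equality, and with the sign of `β_j`,
whenever `β_j ≠ 0`. Hence the values of `l` with a given sign vector form an interval, on which the
estimate is affine in `l`, and there are finitely many transition points. A predictor joining the
active set `B` at a positive transition point `l` has correlation exactly `l` in absolute value, so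
`l` is a linear function of `y`, and substituting it into the fit gives a matrix of trace `|B|`,
because the correction of `H_B` has rank one with its row factor orthogonal to its column factor.
If two predictors join or leave together, the two expressions for `l` put `y` on a hyperplane;
therefore, off finitely many hyperplanes, the size of the active set changes by one at a time and
takes every value from `0` to `p`.

Under the positive cone condition the active sets decrease in `l`, so the last transition point with
`k` nonzero coefficients is the smallest `l` with at most `k` of them, and the fit there is
continuous in `y`. Since it agrees at each `y` with one of finitely many linear maps of trace `k`,
it is Lipschitz, and almost everywhere its divergence is `k`. By Stein's identity the degrees of
freedom are the expected divergence.
-/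

noncomputable section

section RealSign

theorem real_sign_eq_coe_sign (r : ℝ) : Real.sign r = (SignType.sign r : ℝ) := by
  rcases lt_trichotomy r 0 with h | rfl | h
  · simp [Real.sign_of_neg h, h]
  · simp
  · simp [Real.sign_of_pos h, h]

theorem convex_setOf_real_sign_eq (s : ℝ) : Convex ℝ {x : ℝ | Real.sign x = s} := by
  have hcoe : Monotone ((↑) : SignType → ℝ) := fun a b h => by
    cases a <;> cases b <;> first | exact absurd h (by decide) | norm_num
  have hsign : Monotone Real.sign := fun x x' h => by
    simpa only [real_sign_eq_coe_sign] using hcoe (SignType.sign.monotone h)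
  exact (Set.ordConnected_singleton.preimage_mono hsign).convex

theorem eventually_real_sign_eq {r : ℝ} (hr : r ≠ 0) :
    ∀ᶠ x in nhds r, Real.sign x = Real.sign r := by
  have h : ∀ᶠ x in nhds r, SignType.sign x = SignType.sign r :=
    Filter.tendsto_pure.1 (nhds_discrete SignType ▸ continuousAt_sign_of_ne_zero hr)
  filter_upwards [h] with x hx
  rw [real_sign_eq_coe_sign, hx, real_sign_eq_coe_sign]

theorem sign_mul_self_eq_abs (r : ℝ) : Real.sign r * r = |r| := by
  rw [real_sign_eq_coe_sign, sign_mul_self]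

end RealSign

theorem mem_nhds_of_ordConnected {α : Type*} [ConditionallyCompleteLinearOrder α]
    [TopologicalSpace α] [OrderTopology α] {I : Set α} (hI : I.OrdConnected) {x : α} (hx : x ∈ I)
    (hInf : x ≠ sInf I) (hSup : x ≠ sSup I) : I ∈ nhds x := by
  obtain ⟨a, ha, hax⟩ : ∃ a ∈ I, a < x := by
    by_contra! h
    exact hInf (IsLeast.csInf_eq ⟨hx, h⟩).symm
  obtain ⟨b, hb, hxb⟩ : ∃ b ∈ I, x < b := by
    by_contra! h
    exact hSup (IsGreatest.csSup_eq ⟨hx, h⟩).symm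
  exact Filter.mem_of_superset (Icc_mem_nhds hax hxb) (hI.out ha hb)

theorem forall_mul_sub_le_mul_abs_sub_iff {c l z : ℝ} :
    (∀ x, c * (x - z) ≤ l * (|x| - |z|)) ↔ |c| ≤ l ∧ c * z = l * |z| := by
  constructor
  · intro h
    have hz : c * z = l * |z| := by
      have h₀ := h 0
      have h₂ := h (2 * z)
      rw [abs_mul, abs_two] at h₂
      rw [abs_zero] at h₀
      linarith
    have hle : ∀ x, c * x ≤ l * |x| := fun x => by linarith [h x]
    refine ⟨abs_le'.2 ⟨by simpa using hle 1, by simpa using hle (-1)⟩, hz⟩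
  · rintro ⟨hc, hz⟩ x
    have : c * x ≤ l * |x| := calc
      c * x ≤ |c| * |x| := (le_abs_self _).trans (abs_mul c x).le
      _ ≤ l * |x| := by gcongr
    linarith

theorem sum_abs_add_smul_sub_le {ι : Type*} [Fintype ι] (u v : ι → ℝ) {ε : ℝ} (h₀ : 0 ≤ ε)
    (h₁ : ε ≤ 1) :
    ∑ i, |(u + ε • (v - u)) i| - ∑ i, |u i| ≤ ε * (∑ i, |v i| - ∑ i, |u i|) := by
  simp only [← Finset.sum_sub_distrib, Finset.mul_sum]
  refine Finset.sum_le_sum fun i _ => ?_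
  have hcomb : (u + ε • (v - u)) i = (1 - ε) * u i + ε * v i := by
    simp only [Pi.add_apply, Pi.smul_apply, Pi.sub_apply, smul_eq_mul]
    ring
  have := abs_add_le ((1 - ε) * u i) (ε * v i)
  rw [abs_mul, abs_mul, abs_of_nonneg h₀, abs_of_nonneg (sub_nonneg.2 h₁)] at this
  rw [hcomb]
  linarith

section DotProduct

variable {ι : Type*} [Fintype ι]

theorem dotProduct_self_nonneg (u : ι → ℝ) : 0 ≤ u ⬝ᵥ u :=
  dotProduct_self_star_nonneg u

theorem sq_norm_le_dotProduct_self (u : ι → ℝ) : ‖u‖ ^ 2 ≤ u ⬝ᵥ u := by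
  rw [← Real.le_sqrt (norm_nonneg _) (dotProduct_self_nonneg u),
    pi_norm_le_iff_of_nonneg (Real.sqrt_nonneg _)]
  intro i
  rw [Real.norm_eq_abs]
  refine Real.abs_le_sqrt ?_
  rw [sq]
  exact Finset.single_le_sum (f := fun i => u i * u i) (fun i _ => mul_self_nonneg _)
    (Finset.mem_univ i)

theorem abs_dotProduct_le (u v : ι → ℝ) :
    |u ⬝ᵥ v| ≤ Fintype.card ι * (‖u‖ * ‖v‖) := by
  calc |u ⬝ᵥ v| ≤ ∑ i, |u i| * |v i| := by
        simpa only [dotProduct, abs_mul] using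
          Finset.abs_sum_le_sum_abs (fun i => u i * v i) Finset.univ
    _ ≤ ∑ _i : ι, ‖u‖ * ‖v‖ := by
        gcongr with i
        exacts [norm_le_pi_norm u i, norm_le_pi_norm v i]
    _ = Fintype.card ι * (‖u‖ * ‖v‖) := by simp

theorem abs_sum_abs_sub_sum_abs_le (u v : ι → ℝ) :
    |(∑ i, |u i| - ∑ i, |v i|)| ≤ Fintype.card ι * ‖u - v‖ := by
  calc |(∑ i, |u i| - ∑ i, |v i|)| ≤ ∑ i, |(|u i| - |v i|)| := by
        rw [← Finset.sum_sub_distrib]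
        exact Finset.abs_sum_le_sum_abs _ _
    _ ≤ ∑ _i : ι, ‖u - v‖ :=
        Finset.sum_le_sum fun i _ => (abs_abs_sub_abs_le _ _).trans (norm_le_pi_norm (u - v) i)
    _ = Fintype.card ι * ‖u - v‖ := by simp

end DotProduct

/-! ### Continuous selections from finitely many functions -/

section Selection

variable {E α : Type*} [TopologicalSpace α] [T2Space α] {g : E → α} {F : Set (E → α)}

theorem exists_mem_eq_of_dense [TopologicalSpace E] (hg : Continuous g) (hF : F.Finite)
    (hFc : ∀ f ∈ F, Continuous f) {D : Set E} (hD : Dense D) (h : ∀ x ∈ D, ∃ f ∈ F, g x = f x)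
    (x : E) : ∃ f ∈ F, g x = f x := by
  have hcl : IsClosed (⋃ f ∈ F, {x | g x = f x}) :=
    hF.isClosed_biUnion fun f hf => isClosed_eq hg (hFc f hf)
  have hsub : D ⊆ ⋃ f ∈ F, {x | g x = f x} := fun x hx => by simpa using h x hx
  simpa using hcl.closure_subset_iff.2 hsub (hD x)

theorem eventuallyEq_of_forall_exists_mem_eq [TopologicalSpace E] (hg : Continuous g)
    (hF : F.Finite) (hFc : ∀ f ∈ F, Continuous f) (h : ∀ x, ∃ f ∈ F, g x = f x) {f₀ : E → α}
    {x₀ : E} (hf₀ : ∀ f ∈ F, g x₀ = f x₀ → f = f₀) : g =ᶠ[nhds x₀] f₀ := by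
  have hne : ∀ᶠ x in nhds x₀, ∀ f ∈ F, f ≠ f₀ → g x ≠ f x :=
    (Filter.eventually_all_finite hF).2 fun f hf => by
      by_cases hff₀ : f = f₀
      · exact .of_forall fun _ hne => absurd hff₀ hne
      · filter_upwards [(isOpen_ne_fun hg (hFc f hf)).mem_nhds fun he => hff₀ (hf₀ f hf he)]
          with x hx _ using hx
  filter_upwards [hne] with x hx
  obtain ⟨f, hf, hgf⟩ := h x
  exact hgf.trans (congrFun (not_not.1 fun hff₀ => hx f hf hff₀ hgf) x)

end Selection

section LipschitzSelection

variable {α : Type*} [MetricSpace α] {K : ℝ≥0}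

/-- Continuous induction: by the pigeonhole principle, arbitrarily close to the right of each `x`
there are points at which `φ` equals the same function of the family, hence also at `x`. -/
theorem lipschitzWith_real_of_forall_exists_mem_eq {φ : ℝ → α} {F : Set (ℝ → α)}
    (hφ : Continuous φ) (hF : F.Finite) (hFK : ∀ f ∈ F, LipschitzWith K f)
    (h : ∀ t, ∃ f ∈ F, φ t = f t) : LipschitzWith K φ := by
  refine LipschitzWith.of_dist_le_mul fun a b => ?_
  wlog hab : a ≤ b generalizing a b
  · rw [dist_comm, dist_comm a]
    exact this b a (le_of_not_ge hab)
  have hclosed : IsClosed {x | dist (φ a) (φ x) ≤ K * (x - a)} :=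
    isClosed_le (by fun_prop) (by fun_prop)
  suffices hsub : Set.Icc a b ⊆ {x | dist (φ a) (φ x) ≤ K * (x - a)} by
    rw [dist_comm a, Real.dist_eq, abs_of_nonneg (sub_nonneg.2 hab)]
    exact hsub (Set.right_mem_Icc.2 hab)
  refine (hclosed.inter isClosed_Icc).Icc_subset_of_forall_exists_gt (by simp) fun x hx y hy => ?_
  obtain ⟨f, hf, hfreq⟩ : ∃ f ∈ F, ∃ᶠ t in nhdsWithin x (Set.Ioi x), φ t = f t :=
    hF.frequently_exists.1 (Filter.Frequently.of_forall h)
  have hfx : φ x = f x :=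
    (isClosed_eq hφ (hFK f hf).continuous).mem_of_frequently_of_tendsto hfreq
      (Filter.tendsto_id.mono_left nhdsWithin_le_nhds)
  obtain ⟨t, hft, ht⟩ := (hfreq.and_eventually (Ioc_mem_nhdsGT hy)).exists
  refine ⟨t, ?_, ht⟩
  calc dist (φ a) (φ t) ≤ dist (φ a) (φ x) + dist (f x) (f t) := by
        rw [← hfx, ← hft]
        exact dist_triangle _ _ _
    _ ≤ K * (x - a) + K * (t - x) := by
        refine add_le_add hx.1 (((hFK f hf).dist_le_mul x t).trans_eq ?_)
        rw [dist_comm, Real.dist_eq, abs_of_pos (sub_pos.2 ht.1)]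
    _ = K * (t - a) := by ring

theorem lipschitzWith_of_forall_exists_mem_eq {E : Type*} [NormedAddCommGroup E]
    [NormedSpace ℝ E] {g : E → α} {F : Set (E → α)} (hg : Continuous g) (hF : F.Finite)
    (hFK : ∀ f ∈ F, LipschitzWith K f) (h : ∀ x, ∃ f ∈ F, g x = f x) : LipschitzWith K g := by
  refine LipschitzWith.of_dist_le_mul fun a b => ?_
  have hline : LipschitzWith (K * nndist a b) fun t : ℝ => g (AffineMap.lineMap a b t) := by
    refine lipschitzWith_real_of_forall_exists_mem_eq
      (F := (fun f t => f (AffineMap.lineMap a b t)) '' F)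
      (hg.comp AffineMap.lineMap_continuous) (hF.image _) ?_ fun t => ?_
    · rintro _ ⟨f, hf, rfl⟩
      exact (hFK f hf).comp (lipschitzWith_lineMap a b)
    · obtain ⟨f, hf, hgf⟩ := h (AffineMap.lineMap a b t)
      exact ⟨_, ⟨f, hf, rfl⟩, hgf⟩
  simpa using hline.dist_le_mul 0 1

theorem exists_lipschitzWith_of_forall_exists_mem_eq {E G : Type*} [NormedAddCommGroup E]
    [NormedSpace ℝ E] [NormedAddCommGroup G] [NormedSpace ℝ G] {g : E → G} {F : Set (E →L[ℝ] G)}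
    (hg : Continuous g) (hF : F.Finite) (h : ∀ x, ∃ f ∈ F, g x = f x) :
    ∃ K, LipschitzWith K g := by
  obtain ⟨K, hK⟩ := (hF.image fun f => ‖f‖₊).bddAbove
  refine ⟨K, lipschitzWith_of_forall_exists_mem_eq (F := DFunLike.coe '' F) hg (hF.image _) ?_
    fun x => ?_⟩
  · rintro _ ⟨f, hf, rfl⟩
    exact f.lipschitz.weaken (hK ⟨f, hf, rfl⟩)
  · obtain ⟨f, hf, hgf⟩ := h x
    exact ⟨f, ⟨f, hf, rfl⟩, hgf⟩

end LipschitzSelection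

/-! ### Stein's identity -/

theorem memLp_of_lipschitzWith {E F : Type*} [NormedAddCommGroup E] [MeasurableSpace E]
    [NormedAddCommGroup F] {ν : Measure E} [IsFiniteMeasure ν] {q : ℝ≥0∞} (hν : MemLp id q ν)
    {f : E → F} {K : ℝ≥0} (hf : LipschitzWith K f) : MemLp f q ν := by
  have hf₀ : LipschitzWith K fun x => f x - f 0 :=
    LipschitzWith.of_dist_le_mul fun x y => by simpa only [dist_sub_right] using hf.dist_le_mul x y
  exact ((hf₀.comp_memLp (sub_self _) hν).add (memLp_const (f 0))).ae_eq
    (.of_forall fun x => sub_add_cancel (f x) (f 0))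

section GaussianReal

variable {m : ℝ} {v : ℝ≥0}

theorem integrable_gaussianReal_iff {E : Type*} [NormedAddCommGroup E] [NormedSpace ℝ E]
    (hv : v ≠ 0) {f : ℝ → E} :
    Integrable f (gaussianReal m v) ↔ Integrable fun t => gaussianPDFReal m v t • f t := by
  rw [gaussianReal_of_var_ne_zero m hv, integrable_withDensity_iff_integrable_smul'
    (measurable_gaussianPDF m v) (.of_forall fun _ => gaussianPDF_lt_top)]
  simp only [toReal_gaussianPDF]

theorem hasDerivAt_gaussianPDFReal (m : ℝ) (v : ℝ≥0) (t : ℝ) :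
    HasDerivAt (gaussianPDFReal m v) (-((t - m) / v) * gaussianPDFReal m v t) t := by
  have hexponent : HasDerivAt (fun x : ℝ => -(x - m) ^ 2 / (2 * v)) (-((t - m) / v)) t := by
    refine ((((hasDerivAt_id' t).sub_const m).fun_pow 2).fun_neg.div_const
      (2 * (v : ℝ))).congr_deriv ?_
    simp only [Nat.cast_ofNat, Nat.add_one_sub_one, pow_one, mul_one]
    rw [neg_div, mul_div_mul_left _ _ two_ne_zero]
  refine (hexponent.exp.const_mul (√(2 * Real.pi * v))⁻¹).congr_deriv ?_
  rw [gaussianPDFReal]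
  ring

theorem contDiff_gaussianPDFReal (m : ℝ) (v : ℝ≥0) {k : WithTop ℕ∞} :
    ContDiff ℝ k (gaussianPDFReal m v) := by
  rw [gaussianPDFReal_def]
  fun_prop

theorem tendsto_abs_sub_pow_mul_gaussianPDFReal (m : ℝ) (hv : v ≠ 0) (k : ℕ) :
    Filter.Tendsto (fun t => |t - m| ^ k * gaussianPDFReal m v t) (Filter.cocompact ℝ)
      (nhds 0) := by
  have ha : 0 < (2 * (v : ℝ))⁻¹ := by positivity
  have hshift : Filter.Tendsto (fun t : ℝ => t - m) (Filter.cocompact ℝ) (Filter.cocompact ℝ) :=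
    (Homeomorph.subRight m).isClosedEmbedding.tendsto_cocompact
  have h := ((tendsto_rpow_abs_mul_exp_neg_mul_sq_cocompact ha k).comp hshift).const_mul
    (√(2 * Real.pi * v))⁻¹
  rw [mul_zero] at h
  refine h.congr fun t => ?_
  simp only [Function.comp_apply, Real.rpow_natCast, gaussianPDFReal]
  rw [show -(t - m) ^ 2 / (2 * (v : ℝ)) = -(2 * (v : ℝ))⁻¹ * (t - m) ^ 2 by ring]
  ring

variable {f : ℝ → ℝ} {K : ℝ≥0} (hf : LipschitzWith K f)
include hf

theorem tendsto_mul_gaussianPDFReal_cocompact (hv : v ≠ 0) :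
    Filter.Tendsto (fun t => f t * gaussianPDFReal m v t) (Filter.cocompact ℝ) (nhds 0) := by
  have h := ((tendsto_abs_sub_pow_mul_gaussianPDFReal m hv 0).const_mul |f m|).add
    ((tendsto_abs_sub_pow_mul_gaussianPDFReal m hv 1).const_mul (K : ℝ))
  simp only [mul_zero, add_zero, pow_zero, one_mul, pow_one] at h
  refine squeeze_zero_norm (fun t => ?_) h
  have hgrowth : |f t| ≤ |f m| + K * |t - m| := by
    have hdist := hf.dist_le_mul t m
    rw [Real.dist_eq, Real.dist_eq] at hdist
    linarith [abs_sub_abs_le_abs_sub (f t) (f m)]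
  calc ‖f t * gaussianPDFReal m v t‖ = |f t| * gaussianPDFReal m v t := by
        rw [norm_mul, Real.norm_eq_abs, Real.norm_of_nonneg (gaussianPDFReal_nonneg m v t)]
    _ ≤ (|f m| + K * |t - m|) * gaussianPDFReal m v t :=
        mul_le_mul_of_nonneg_right hgrowth (gaussianPDFReal_nonneg m v t)
    _ = _ := by ring

theorem intervalIntegral_gaussianPDFReal_mul_stein (hv : v ≠ 0) (a b : ℝ) :
    ∫ t in a..b, gaussianPDFReal m v t * (f t * (t - m) - v * deriv f t) =
      -v * (f b * gaussianPDFReal m v b - f a * gaussianPDFReal m v a) := by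
  have hv₀ : (v : ℝ) ≠ 0 := by positivity
  rw [← AbsolutelyContinuousOnInterval.integral_deriv_mul_eq_sub
    hf.lipschitzOnWith.absolutelyContinuousOnInterval
    (contDiff_gaussianPDFReal m v).contDiffOn.absolutelyContinuousOnInterval,
    ← intervalIntegral.integral_const_mul]
  refine intervalIntegral.integral_congr fun t _ => ?_
  simp only [(hasDerivAt_gaussianPDFReal m v t).deriv]
  field_simp
  ring

theorem integrable_gaussianReal_stein :
    Integrable (fun t => f t * (t - m) - v * deriv f t) (gaussianReal m v) := by
  have hid : MemLp id 2 (gaussianReal m v) := memLp_id_gaussianReal' 2 (by simp)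
  have hderiv : Integrable (deriv f) (gaussianReal m v) :=
    (integrable_const (K : ℝ)).mono' (measurable_deriv f).aestronglyMeasurable
      (.of_forall fun t => norm_deriv_le_of_lipschitz hf)
  exact ((memLp_of_lipschitzWith hid hf).integrable_mul (hid.sub (memLp_const m))).sub
    (hderiv.const_mul _)

/-- Stein's identity: integrate by parts on `[-R, R]` and let `R → ∞`. -/
theorem integral_gaussianReal_stein :
    ∫ t, (f t * (t - m) - v * deriv f t) ∂gaussianReal m v = 0 := by
  rcases eq_or_ne v 0 with rfl | hv
  · simp
  rw [integral_gaussianReal_eq_integral_smul hv]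
  have hlim := intervalIntegral_tendsto_integral
    ((integrable_gaussianReal_iff hv).1 (integrable_gaussianReal_stein (m := m) hf))
    Filter.tendsto_neg_atTop_atBot Filter.tendsto_id
  simp only [smul_eq_mul, id, intervalIntegral_gaussianPDFReal_mul_stein hf hv] at hlim
  have hboundary := tendsto_mul_gaussianPDFReal_cocompact (m := m) hf hv
  rw [cocompact_eq_atBot_atTop, Filter.tendsto_sup] at hboundary
  have hzero := (hboundary.2.sub
    (hboundary.1.comp Filter.tendsto_neg_atTop_atBot)).const_mul (-(v : ℝ))
  simp only [sub_zero, mul_zero] at hzero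
  exact tendsto_nhds_unique hlim hzero

end GaussianReal

section Pi

variable {ι : Type*} [DecidableEq ι]

theorem update_add_smul_single (y : ι → ℝ) (i : ι) (t s : ℝ) :
    Function.update y i t + s • Pi.single i (1 : ℝ) = Function.update y i (t + s) := by
  ext j
  by_cases hj : j = i
  · subst hj
    simp
  · simp [hj]

theorem lineDeriv_update (g : (ι → ℝ) → ℝ) (y : ι → ℝ) (i : ι) (t : ℝ) :
    lineDeriv ℝ g (Function.update y i t) (Pi.single i 1) =
      deriv (fun s => g (Function.update y i s)) t := by
  simp only [lineDeriv, update_add_smul_single]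
  rw [deriv_comp_const_add (f := fun s => g (Function.update y i s)), add_zero]

variable [Fintype ι]

theorem measurePreserving_update {π : ι → Type*} [∀ i, MeasurableSpace (π i)]
    (γ : ∀ i, Measure (π i)) [∀ i, SigmaFinite (γ i)] (i : ι) [IsProbabilityMeasure (γ i)] :
    MeasurePreserving (fun q : (∀ i, π i) × π i => Function.update q.1 i q.2)
      ((Measure.pi γ).prod (γ i)) (Measure.pi γ) := by
  refine ⟨measurable_update', (Measure.pi_eq fun s hs => ?_).symm⟩
  have hpre : (fun q : (∀ i, π i) × π i => Function.update q.1 i q.2) ⁻¹' Set.univ.pi s =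
      (Set.univ.pi (Function.update s i Set.univ)) ×ˢ s i := by
    ext q
    simp only [Set.mem_preimage, Set.mem_univ_pi, Set.mem_prod]
    rw [Function.forall_update_iff q.1 (p := fun j x => x ∈ s j),
      Function.forall_update_iff s (p := fun j t => q.1 j ∈ t)]
    simp [and_comm]
  rw [Measure.map_apply measurable_update' (.univ_pi hs), hpre, Measure.prod_prod,
    Measure.pi_pi, ← Finset.mul_prod_erase _ _ (Finset.mem_univ i),
    ← Finset.mul_prod_erase _ (fun j => γ j (s j)) (Finset.mem_univ i), Function.update_self,
    measure_univ, one_mul, mul_comm]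
  congr 1
  refine Finset.prod_congr rfl fun j hj => ?_
  rw [Function.update_of_ne (Finset.ne_of_mem_erase hj)]

theorem integral_pi_eq_integral_integral_update {π : ι → Type*} [∀ i, MeasurableSpace (π i)]
    {E : Type*} [NormedAddCommGroup E] [NormedSpace ℝ E] {γ : ∀ i, Measure (π i)}
    [∀ i, SigmaFinite (γ i)] (i : ι) [IsProbabilityMeasure (γ i)] {f : (∀ i, π i) → E}
    (hf : Integrable f (Measure.pi γ)) :
    ∫ y, f y ∂Measure.pi γ = ∫ y, ∫ t, f (Function.update y i t) ∂γ i ∂Measure.pi γ := by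
  have hmp := measurePreserving_update γ i
  have hfm : AEStronglyMeasurable f (Measure.map _ ((Measure.pi γ).prod (γ i))) :=
    hmp.map_eq ▸ hf.aestronglyMeasurable
  have hprod := integral_map hmp.measurable.aemeasurable hfm
  rw [hmp.map_eq] at hprod
  exact hprod.trans (integral_prod _ (hmp.integrable_comp_of_integrable hf))

theorem lipschitzWith_update (y : ι → ℝ) (i : ι) :
    LipschitzWith 1 fun t : ℝ => Function.update y i t := by
  refine LipschitzWith.of_dist_le_mul fun t u => ?_
  rw [NNReal.coe_one, one_mul, dist_pi_le_iff dist_nonneg]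
  intro j
  by_cases hj : j = i
  · subst hj
    simp
  · simp [hj]

end Pi

theorem ae_dotProduct_ne_zero {ι : Type*} [Fintype ι] (γ : ι → Measure ℝ)
    [∀ i, IsProbabilityMeasure (γ i)] [∀ i, NullSingletonClass (γ i)] {a : ι → ℝ} (ha : a ≠ 0) :
    ∀ᵐ y ∂Measure.pi γ, a ⬝ᵥ y ≠ 0 := by
  classical
  obtain ⟨i, hi⟩ := Function.ne_iff.1 ha
  have hmeas : MeasurableSet {y : ι → ℝ | a ⬝ᵥ y = 0} :=
    measurableSet_eq_fun (by unfold dotProduct; fun_prop) measurable_const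
  rw [ae_iff]
  simp only [not_not]
  rw [← (measurePreserving_update γ i).measure_preimage hmeas.nullMeasurableSet,
    Measure.measure_prod_null (measurable_update' hmeas)]
  refine .of_forall fun y => Set.Subsingleton.measure_zero (fun t ht u hu => ?_) _
  have hline : ∀ r, a ⬝ᵥ Function.update y i r = a ⬝ᵥ Function.update y i 0 + r * a i := by
    intro r
    rw [← zero_add r, ← update_add_smul_single, dotProduct_add, dotProduct_smul,
      dotProduct_single_one, zero_add, smul_eq_mul]
  have ht' : a ⬝ᵥ Function.update y i t = 0 := ht
  have hu' : a ⬝ᵥ Function.update y i u = 0 := hu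
  exact mul_right_cancel₀ hi (by linarith [hline t, hline u])

theorem integrable_lineDeriv {E F : Type*} [NormedAddCommGroup E] [NormedSpace ℝ E]
    [MeasurableSpace E] [OpensMeasurableSpace E] [NormedAddCommGroup F] [NormedSpace ℝ F]
    [CompleteSpace F] [SecondCountableTopologyEither E F] {ν : Measure E} [IsFiniteMeasure ν]
    {f : E → F} {K : ℝ≥0} (hf : LipschitzWith K f) (w : E) :
    Integrable (fun x => lineDeriv ℝ f x w) ν :=
  (integrable_const (K * ‖w‖)).mono' (aestronglyMeasurable_lineDeriv hf.continuous ν)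
    (.of_forall fun _ => norm_lineDeriv_le_of_lipschitz ℝ hf)

section GaussianPi

variable {ι : Type*} [Fintype ι]

theorem memLp_id_pi {γ : ι → Measure ℝ} [∀ i, IsProbabilityMeasure (γ i)] {q : ℝ≥0∞}
    (hγ : ∀ i, MemLp id q (γ i)) : MemLp id q (Measure.pi γ) :=
  memLp_pi_iff.2 fun i => (hγ i).comp_measurePreserving (measurePreserving_eval γ i)

variable {μ : ι → ℝ} {v : ι → ℝ≥0}

theorem memLp_id_pi_gaussianReal :
    MemLp id 2 (Measure.pi fun i => gaussianReal (μ i) (v i)) :=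
  memLp_id_pi fun _ => memLp_id_gaussianReal' 2 (by simp)

theorem integral_eval_pi_gaussianReal (i : ι) :
    ∫ y, y i ∂Measure.pi (fun i => gaussianReal (μ i) (v i)) = μ i := by
  have h := measurePreserving_eval (fun i => gaussianReal (μ i) (v i)) i
  rw [← integral_id_gaussianReal (μ := μ i) (v := v i), ← h.map_eq,
    integral_map h.measurable.aemeasurable (by fun_prop)]

variable [DecidableEq ι] {g : (ι → ℝ) → ℝ} {K : ℝ≥0} (hg : LipschitzWith K g)
include hg

/-- Resampling the coordinate `i` preserves the product measure, which reduces the claim to Stein's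
identity on a line. -/
theorem integral_pi_gaussianReal_stein (i : ι) :
    ∫ y, g y * (y i - μ i) ∂Measure.pi (fun i => gaussianReal (μ i) (v i)) =
      v i * ∫ y, lineDeriv ℝ g y (Pi.single i 1)
        ∂Measure.pi (fun i => gaussianReal (μ i) (v i)) := by
  have hprod : Integrable (fun y => g y * (y i - μ i))
      (Measure.pi fun i => gaussianReal (μ i) (v i)) :=
    (memLp_of_lipschitzWith memLp_id_pi_gaussianReal hg).integrable_mul
      ((memLp_id_pi_gaussianReal.eval i).sub (memLp_const (μ i)))
  have hderiv : Integrable (fun y => v i * lineDeriv ℝ g y (Pi.single i 1))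
      (Measure.pi fun i => gaussianReal (μ i) (v i)) :=
    (integrable_lineDeriv hg (Pi.single i 1)).const_mul _
  have hsub : Integrable (fun y => g y * (y i - μ i) - v i * lineDeriv ℝ g y (Pi.single i 1))
      (Measure.pi fun i => gaussianReal (μ i) (v i)) :=
    hprod.sub hderiv
  rw [← integral_const_mul, ← sub_eq_zero, ← integral_sub hprod hderiv,
    integral_pi_eq_integral_integral_update i hsub]
  refine integral_eq_zero_of_ae (.of_forall fun y => ?_)
  simp only [lineDeriv_update, Function.update_self]
  exact integral_gaussianReal_stein (hg.comp (lipschitzWith_update y i))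

theorem covariance_pi_gaussianReal (i : ι) :
    cov[g, fun y => y i; Measure.pi fun i => gaussianReal (μ i) (v i)] =
      v i * ∫ y, lineDeriv ℝ g y (Pi.single i 1)
        ∂Measure.pi (fun i => gaussianReal (μ i) (v i)) := by
  have hgL := memLp_of_lipschitzWith (memLp_id_pi_gaussianReal (μ := μ) (v := v)) hg
  have heval : MemLp (fun y => y i) 2 (Measure.pi fun i => gaussianReal (μ i) (v i)) :=
    memLp_id_pi_gaussianReal.eval i
  have hmul : Integrable (fun y => g y * y i) (Measure.pi fun i => gaussianReal (μ i) (v i)) :=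
    hgL.integrable_mul heval
  rw [covariance_eq_sub hgL heval, ← integral_pi_gaussianReal_stein hg]
  simp only [mul_sub]
  rw [integral_sub hmul ((hgL.integrable (by norm_num)).mul_const _), integral_mul_const,
    integral_eval_pi_gaussianReal]
  rfl

end GaussianPi

theorem lineDeriv_mulVec_apply {m n : Type*} [Fintype n] [DecidableEq n] (S : Matrix m n ℝ)
    (y : n → ℝ) (i : m) (j : n) :
    lineDeriv ℝ (fun y => (S *ᵥ y) i) y (Pi.single j 1) = S i j := by
  have hlin : ∀ t : ℝ, (S *ᵥ (y + t • Pi.single j 1)) i = (S *ᵥ y) i + t * S i j := fun t => by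
    rw [Matrix.mulVec_add, Matrix.mulVec_smul, Matrix.mulVec_single_one]
    rfl
  simp [lineDeriv, hlin]

namespace Lasso

/-! ### The Karush–Kuhn–Tucker conditions -/

section

variable {n p : ℕ}

section KKT

/-- The gradient `2 Xᵀ (y - X β)` of the negative residual sum of squares. -/
def score (X : Matrix (Fin n) (Fin p) ℝ) (y : Fin n → ℝ) (β : Fin p → ℝ) : Fin p → ℝ :=
  (2 : ℝ) • (Xᵀ *ᵥ (y - X *ᵥ β))

/-- The Karush–Kuhn–Tucker conditions for the lasso criterion: the score is a subgradient of the
penalty at `β`. The condition `score j = l * sign (β j)` on the support of `β` is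
multiplied by `β j`, so that it holds for every `j`. -/
def KKT (X : Matrix (Fin n) (Fin p) ℝ) (y : Fin n → ℝ) (l : ℝ) (β : Fin p → ℝ) : Prop :=
  ∀ j, |score X y β j| ≤ l ∧ score X y β j * β j = l * |β j|

variable {X : Matrix (Fin n) (Fin p) ℝ} {y y' : Fin n → ℝ} {l l' : ℝ} {β β' : Fin p → ℝ}

theorem score_dotProduct (X : Matrix (Fin n) (Fin p) ℝ) (y : Fin n → ℝ) (β b : Fin p → ℝ) :
    score X y β ⬝ᵥ b = 2 * ((y - X *ᵥ β) ⬝ᵥ (X *ᵥ b)) := by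
  rw [score, smul_dotProduct, Matrix.mulVec_transpose, ← Matrix.dotProduct_mulVec, smul_eq_mul]

theorem score_add_smul {a b : ℝ} (hab : a + b = 1) (β β' : Fin p → ℝ) :
    score X y (a • β + b • β') = a • score X y β + b • score X y β' := by
  have hy : y = a • y + b • y := by rw [← add_smul, hab, one_smul]
  have : y - X *ᵥ (a • β + b • β') = a • (y - X *ᵥ β) + b • (y - X *ᵥ β') := by
    rw [Matrix.mulVec_add, Matrix.mulVec_smul, Matrix.mulVec_smul]
    nth_rewrite 1 [hy]
    module
  rw [score, this, Matrix.mulVec_add, Matrix.mulVec_smul, Matrix.mulVec_smul, score, score]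
  module

theorem continuous_score (X : Matrix (Fin n) (Fin p) ℝ) :
    Continuous fun q : (Fin n → ℝ) × (Fin p → ℝ) => score X q.1 q.2 :=
  (continuous_const.matrix_mulVec
    (continuous_fst.sub (continuous_const.matrix_mulVec continuous_snd))).const_smul (2 : ℝ)

theorem objective_eq_objective_add (X : Matrix (Fin n) (Fin p) ℝ) (y : Fin n → ℝ) (l : ℝ)
    (β b : Fin p → ℝ) :
    objective X y l b = objective X y l β + (X *ᵥ (b - β)) ⬝ᵥ (X *ᵥ (b - β))
      + (l * (∑ j, |b j| - ∑ j, |β j|) - score X y β ⬝ᵥ (b - β)) := by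
  have hsq : ∑ i, (y i - (X *ᵥ b) i) ^ 2 = ∑ i, (y i - (X *ᵥ β) i) ^ 2
      + (X *ᵥ (b - β)) ⬝ᵥ (X *ᵥ (b - β)) - 2 * ((y - X *ᵥ β) ⬝ᵥ (X *ᵥ (b - β))) := by
    simp only [dotProduct, Finset.mul_sum, ← Finset.sum_add_distrib, ← Finset.sum_sub_distrib,
      Matrix.mulVec_sub, Pi.sub_apply]
    exact Finset.sum_congr rfl fun i _ => by ring
  rw [score_dotProduct, objective, objective, hsq]
  ring

theorem kkt_iff_forall_score_dotProduct_le :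
    KKT X y l β ↔ ∀ b, score X y β ⬝ᵥ (b - β) ≤ l * (∑ j, |b j| - ∑ j, |β j|) := by
  simp only [KKT, ← forall_mul_sub_le_mul_abs_sub_iff]
  constructor
  · intro h b
    rw [← Finset.sum_sub_distrib, Finset.mul_sum]
    exact Finset.sum_le_sum fun j _ => h j (b j)
  · intro h j x
    have hsum : ∑ i, |Function.update β j x i| - ∑ i, |β i| = |x| - |β j| := by
      rw [← Finset.sum_sub_distrib, Finset.sum_eq_single j _ (by simp)]
      · simp
      · intro i _ hij
        simp [Function.update_of_ne hij]
    have hdiff : Function.update β j x - β = Pi.single j (x - β j) := by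
      ext i
      rcases eq_or_ne i j with rfl | hij <;> simp [*]
    simpa only [hsum, hdiff, dotProduct_single] using h (Function.update β j x)

theorem KKT.objective_add_le (h : KKT X y l β) (b : Fin p → ℝ) :
    objective X y l β + (X *ᵥ (b - β)) ⬝ᵥ (X *ᵥ (b - β)) ≤ objective X y l b := by
  rw [objective_eq_objective_add X y l β b]
  linarith [kkt_iff_forall_score_dotProduct_le.1 h b]

theorem KKT.of_forall_objective_le (hl : 0 ≤ l) (h : ∀ b, objective X y l β ≤ objective X y l b) :
    KKT X y l β := by
  rw [kkt_iff_forall_score_dotProduct_le]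
  intro b
  set q := (X *ᵥ (b - β)) ⬝ᵥ (X *ᵥ (b - β))
  set D := l * (∑ j, |b j| - ∑ j, |β j|) - score X y β ⬝ᵥ (b - β) with hD
  have hstep : ∀ ε ∈ Set.Ioc (0 : ℝ) 1, 0 ≤ ε * q + D := by
    rintro ε ⟨hε₀, hε₁⟩
    have hmin := h (β + ε • (b - β))
    rw [objective_eq_objective_add X y l β (β + ε • (b - β)), add_sub_cancel_left,
      Matrix.mulVec_smul, dotProduct_smul, smul_dotProduct, dotProduct_smul, smul_eq_mul,
      smul_eq_mul, smul_eq_mul] at hmin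
    have hpenalty := mul_le_mul_of_nonneg_left (sum_abs_add_smul_sub_le β b hε₀.le hε₁) hl
    refine nonneg_of_mul_nonneg_right (a := ε) ?_ hε₀
    rw [hD]
    linarith
  have hlim : Filter.Tendsto (fun ε : ℝ => ε * q + D) (nhdsWithin 0 (Set.Ioi 0)) (nhds D) := by
    have : Continuous fun ε : ℝ => ε * q + D := by fun_prop
    simpa only [zero_mul, zero_add] using (this.tendsto 0).mono_left nhdsWithin_le_nhds
  exact sub_nonneg.1 (ge_of_tendsto hlim (Filter.mem_of_superset (Ioc_mem_nhdsGT one_pos) hstep))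

theorem KKT.dotProduct_le (h : KKT X y l β) (h' : KKT X y' l' β') :
    2 * ((X *ᵥ (β - β')) ⬝ᵥ (X *ᵥ (β - β'))) ≤
      2 * ((y - y') ⬝ᵥ (X *ᵥ (β - β'))) + (l' - l) * (∑ j, |β j| - ∑ j, |β' j|) := by
  have hβ := kkt_iff_forall_score_dotProduct_le.1 h β'
  have hβ' := kkt_iff_forall_score_dotProduct_le.1 h' β
  have hneg : X *ᵥ (β' - β) = -(X *ᵥ (β - β')) := by rw [← Matrix.mulVec_neg, neg_sub]
  rw [score_dotProduct, hneg, dotProduct_neg, sub_dotProduct] at hβ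
  rw [score_dotProduct, sub_dotProduct] at hβ'
  have hw : (X *ᵥ (β - β')) ⬝ᵥ (X *ᵥ (β - β')) =
      (X *ᵥ β) ⬝ᵥ (X *ᵥ (β - β')) - (X *ᵥ β') ⬝ᵥ (X *ᵥ (β - β')) := by
    rw [← sub_dotProduct, ← Matrix.mulVec_sub]
  rw [hw, sub_dotProduct y y']
  linarith

theorem KKT.score_eq (h : KKT X y l β) {j : Fin p} (hj : β j ≠ 0) :
    score X y β j = l * Real.sign (β j) := by
  refine mul_right_cancel₀ hj ?_
  rw [(h j).2, mul_assoc, sign_mul_self_eq_abs]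

theorem KKT.add_smul_of_sign_eq {s : Fin p → ℝ} (h : KKT X y l β) (h' : KKT X y l' β')
    (hs : ∀ j, Real.sign (β j) = s j) (hs' : ∀ j, Real.sign (β' j) = s j)
    {a b : ℝ} (ha : 0 ≤ a) (hb : 0 ≤ b) (hab : a + b = 1) :
    KKT X y (a * l + b * l') (a • β + b • β') := by
  intro j
  have hscore : score X y (a • β + b • β') j = a * score X y β j + b * score X y β' j := by
    rw [score_add_smul hab]; rfl
  have hsign : Real.sign ((a • β + b • β') j) = s j :=
    convex_setOf_real_sign_eq (s j) (hs j) (hs' j) ha hb hab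
  constructor
  · calc |score X y (a • β + b • β') j| ≤ a * |score X y β j| + b * |score X y β' j| := by
          simpa only [hscore, abs_mul, abs_of_nonneg ha, abs_of_nonneg hb] using
            abs_add_le (a * score X y β j) (b * score X y β' j)
      _ ≤ a * l + b * l' := by
          gcongr
          exacts [(h j).1, (h' j).1]
  · rcases eq_or_ne (s j) 0 with h0 | h0
    · rw [h0, Real.sign_eq_zero_iff] at hsign
      simp [hsign]
    · have hβ : β j ≠ 0 := fun hβ => h0 (by rw [← hs j, hβ, Real.sign_zero])
      have hβ' : β' j ≠ 0 := fun hβ' => h0 (by rw [← hs' j, hβ', Real.sign_zero])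
      rw [hscore, h.score_eq hβ, h'.score_eq hβ', hs, hs', ← sign_mul_self_eq_abs, hsign]
      ring

end KKT

section Coef

theorem exists_sq_norm_le_mul_dotProduct {X : Matrix (Fin n) (Fin p) ℝ}
    (hX : LinearIndependent ℝ X.col) :
    ∃ C : ℝ, 0 < C ∧ ∀ b : Fin p → ℝ, ‖b‖ ^ 2 ≤ C * ((X *ᵥ b) ⬝ᵥ (X *ᵥ b)) := by
  obtain ⟨K, hK, h⟩ := X.mulVecLin.exists_antilipschitzWith
    (LinearMap.ker_eq_bot.2 (Matrix.mulVec_injective_iff.2 hX))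
  refine ⟨(K : ℝ) ^ 2, by positivity, fun b => ?_⟩
  have hb : ‖b‖ ≤ K * ‖X *ᵥ b‖ := by simpa using h.le_mul_norm_sub b 0
  calc ‖b‖ ^ 2 ≤ (K * ‖X *ᵥ b‖) ^ 2 := by gcongr
    _ = K ^ 2 * ‖X *ᵥ b‖ ^ 2 := by ring
    _ ≤ _ := by gcongr; exact sq_norm_le_dotProduct_self _

variable {X : Matrix (Fin n) (Fin p) ℝ} (hX : LinearIndependent ℝ X.col)

include hX in
theorem exists_forall_objective_le (y : Fin n → ℝ) {l : ℝ} (hl : 0 ≤ l) :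
    ∃ β, ∀ b, objective X y l β ≤ objective X y l b := by
  have hcont : Continuous (objective X y l) := by
    unfold objective
    simp only [Matrix.mulVec, dotProduct]
    fun_prop
  refine hcont.exists_forall_le' 0 ?_
  obtain ⟨C, hC, hcoercive⟩ := exists_sq_norm_le_mul_dotProduct hX
  have hlim : Filter.Tendsto (fun b : Fin p → ℝ => ‖b‖ ^ 2) (Filter.cocompact _) Filter.atTop :=
    (Filter.tendsto_pow_atTop two_ne_zero).comp tendsto_norm_cocompact_atTop
  filter_upwards [hlim.eventually_ge_atTop (C * (4 * (y ⬝ᵥ y)))] with b hb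
  have hlarge : 4 * (y ⬝ᵥ y) ≤ (X *ᵥ b) ⬝ᵥ (X *ᵥ b) :=
    le_of_mul_le_mul_left (hb.trans (hcoercive b)) hC
  have hzero : objective X y l 0 = y ⬝ᵥ y := by simp [objective, dotProduct, sq]
  have hparallelogram :
      (X *ᵥ b) ⬝ᵥ (X *ᵥ b) ≤ 2 * ∑ i, (y i - (X *ᵥ b) i) ^ 2 + 2 * (y ⬝ᵥ y) := by
    simp only [dotProduct, Finset.mul_sum, ← Finset.sum_add_distrib]
    exact Finset.sum_le_sum fun i _ => by nlinarith [sq_nonneg (2 * y i - (X *ᵥ b) i)]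
  have hpenalty : 0 ≤ l * ∑ j, |b j| :=
    mul_nonneg hl (Finset.sum_nonneg fun j _ => abs_nonneg _)
  rw [hzero, objective]
  linarith

include hX in
theorem KKT.eq_of_forall_objective_le {y : Fin n → ℝ} {l : ℝ} {β b : Fin p → ℝ}
    (h : KKT X y l β) (hb : ∀ b', objective X y l b ≤ objective X y l b') : b = β := by
  obtain ⟨C, hC, hcoercive⟩ := exists_sq_norm_le_mul_dotProduct hX
  have hgap : (X *ᵥ (b - β)) ⬝ᵥ (X *ᵥ (b - β)) ≤ 0 := by
    linarith [h.objective_add_le b, hb β]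
  have hsq : ‖b - β‖ ^ 2 ≤ 0 := (hcoercive _).trans (mul_nonpos_of_nonneg_of_nonpos hC.le hgap)
  exact sub_eq_zero.1 (norm_eq_zero.1 (pow_eq_zero_iff two_ne_zero |>.1
    (le_antisymm hsq (sq_nonneg _))))

include hX

theorem existsUnique_forall_objective_le (y : Fin n → ℝ) {l : ℝ} (hl : 0 ≤ l) :
    ∃! β, ∀ b, objective X y l β ≤ objective X y l b := by
  obtain ⟨β, hβ⟩ := exists_forall_objective_le hX y hl
  exact ⟨β, hβ, fun b hb => (KKT.of_forall_objective_le hl hβ).eq_of_forall_objective_le hX hb⟩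

theorem kkt_coef (y : Fin n → ℝ) {l : ℝ} (hl : 0 ≤ l) : KKT X y l (coef X y l) :=
  KKT.of_forall_objective_le hl (Classical.epsilon_spec (exists_forall_objective_le hX y hl))

theorem KKT.coef_eq {y : Fin n → ℝ} {l : ℝ} (hl : 0 ≤ l) {β : Fin p → ℝ} (h : KKT X y l β) :
    coef X y l = β :=
  h.eq_of_forall_objective_le hX (Classical.epsilon_spec (exists_forall_objective_le hX y hl))

theorem exists_norm_coef_sub_le :
    ∃ C : ℝ, 0 ≤ C ∧ ∀ (y y' : Fin n → ℝ) (l l' : ℝ), 0 ≤ l → 0 ≤ l' →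
      ‖coef X y l - coef X y' l'‖ ≤ C * (‖y - y'‖ + |l - l'|) := by
  obtain ⟨C, hC, hcoercive⟩ := exists_sq_norm_le_mul_dotProduct hX
  set M : ℝ := ‖LinearMap.toContinuousLinearMap X.mulVecLin‖
  refine ⟨C * (n * M + p), by positivity, fun y y' l l' hl hl' => ?_⟩
  have hmono := (kkt_coef hX y hl).dotProduct_le (kkt_coef hX y' hl')
  set β := coef X y l
  set β' := coef X y' l'
  have hdata : (y - y') ⬝ᵥ (X *ᵥ (β - β')) ≤ n * M * ‖y - y'‖ * ‖β - β'‖ :=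
    calc (y - y') ⬝ᵥ (X *ᵥ (β - β')) ≤ n * (‖y - y'‖ * ‖X *ᵥ (β - β')‖) := by
          simpa using (le_abs_self _).trans (abs_dotProduct_le (y - y') (X *ᵥ (β - β')))
      _ ≤ n * (‖y - y'‖ * (M * ‖β - β'‖)) := by
          gcongr
          exact (LinearMap.toContinuousLinearMap X.mulVecLin).le_opNorm (β - β')
      _ = _ := by ring
  have hpenalty : (l' - l) * (∑ j, |β j| - ∑ j, |β' j|) ≤ p * |l - l'| * ‖β - β'‖ :=
    calc (l' - l) * (∑ j, |β j| - ∑ j, |β' j|)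
      _ ≤ |l' - l| * |(∑ j, |β j| - ∑ j, |β' j|)| := (le_abs_self _).trans (abs_mul _ _).le
      _ ≤ |l' - l| * (p * ‖β - β'‖) := by
          gcongr
          simpa using abs_sum_abs_sub_sum_abs_le β β'
      _ = p * |l - l'| * ‖β - β'‖ := by rw [abs_sub_comm]; ring
  have hfit : (X *ᵥ (β - β')) ⬝ᵥ (X *ᵥ (β - β')) ≤
      (n * M + p) * (‖y - y'‖ + |l - l'|) * ‖β - β'‖ := by
    have : 0 ≤ (n * M * |l - l'| + p * ‖y - y'‖ + p * |l - l'| / 2) * ‖β - β'‖ := by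
      positivity
    linarith
  by_contra! hlt
  have hpos : 0 < ‖β - β'‖ := lt_of_le_of_lt (by positivity) hlt
  have hsq : ‖β - β'‖ ^ 2 ≤ C * ((n * M + p) * (‖y - y'‖ + |l - l'|) * ‖β - β'‖) :=
    (hcoercive _).trans (by gcongr)
  linarith [mul_lt_mul_of_pos_right hlt hpos]

end Coef

end

/-! ### Correlations -/

section

variable {n p : ℕ} {X : Matrix (Fin n) (Fin p) ℝ} {y : Fin n → ℝ} {l : ℝ} {j : Fin p}

/-- The score at the lasso estimate, that is, twice the inner products of the predictors with the
residual. -/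
def corr (X : Matrix (Fin n) (Fin p) ℝ) (y : Fin n → ℝ) (l : ℝ) : Fin p → ℝ :=
  score X y (coef X y l)

/-- The equicorrelation set, the set of the predictors for which the bound `|corr j| ≤ l` is
attained. For `0 < l` it contains the active set. -/
def equi (X : Matrix (Fin n) (Fin p) ℝ) (y : Fin n → ℝ) (l : ℝ) : Finset (Fin p) :=
  {j | |corr X y l j| = l}

@[simp]
theorem mem_active : j ∈ active X y l ↔ coef X y l j ≠ 0 := by
  simp [active]

@[simp]
theorem mem_equi : j ∈ equi X y l ↔ |corr X y l j| = l := by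
  simp [equi]

theorem sgn_eq_zero_iff : sgn X y l j = 0 ↔ j ∉ active X y l := by
  rw [sgn, Real.sign_eq_zero_iff, mem_active, not_not]

theorem active_congr {l' : ℝ} (h : sgn X y l = sgn X y l') : active X y l = active X y l' := by
  ext j
  rw [← not_iff_not, ← sgn_eq_zero_iff, ← sgn_eq_zero_iff, h]

section

variable (hX : LinearIndependent ℝ X.col)
include hX

theorem abs_corr_le (y : Fin n → ℝ) (hl : 0 ≤ l) (j : Fin p) : |corr X y l j| ≤ l :=
  (kkt_coef hX y hl j).1

theorem corr_mul_coef (y : Fin n → ℝ) (hl : 0 ≤ l) (j : Fin p) :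
    corr X y l j * coef X y l j = l * |coef X y l j| :=
  (kkt_coef hX y hl j).2

theorem corr_of_mem_active (hl : 0 ≤ l) (hj : j ∈ active X y l) :
    corr X y l j = l * sgn X y l j :=
  (kkt_coef hX y hl).score_eq (mem_active.1 hj)

theorem active_subset_equi (y : Fin n → ℝ) (hl : 0 ≤ l) : active X y l ⊆ equi X y l := by
  intro j hj
  rw [mem_equi, corr_of_mem_active hX hl hj, abs_mul, abs_of_nonneg hl, sgn]
  rcases Real.sign_apply_eq_of_ne_zero _ (mem_active.1 hj) with h | h <;> simp [h]

theorem convex_setOf_sgn_eq (y : Fin n → ℝ) (s : Fin p → ℝ) :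
    Convex ℝ {l : ℝ | 0 ≤ l ∧ sgn X y l = s} := by
  rintro l ⟨hl, rfl⟩ l' ⟨hl', hs⟩ a b ha hb hab
  have hnonneg : 0 ≤ a * l + b * l' := by positivity
  refine ⟨hnonneg, funext fun j => ?_⟩
  have hkkt := (kkt_coef hX y hl).add_smul_of_sign_eq (kkt_coef hX y hl') (fun _ => rfl)
    (congrFun hs) ha hb hab
  rw [sgn, smul_eq_mul, smul_eq_mul, hkkt.coef_eq hX hnonneg]
  exact convex_setOf_real_sign_eq _ rfl (congrFun hs j) ha hb hab

section Continuity

variable {α : Type*} {F : Filter α} {u : α → Fin n → ℝ} {v : α → ℝ} (hl : 0 ≤ l)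
  (hu : Filter.Tendsto u F (nhds y)) (hv : Filter.Tendsto v F (nhds l)) (hv₀ : ∀ᶠ a in F, 0 ≤ v a)
include hl hu hv hv₀

theorem tendsto_coef : Filter.Tendsto (fun a => coef X (u a) (v a)) F (nhds (coef X y l)) := by
  obtain ⟨C, -, hC⟩ := exists_norm_coef_sub_le hX
  refine tendsto_iff_norm_sub_tendsto_zero.2 ?_
  have hbound : Filter.Tendsto (fun a => C * (‖u a - y‖ + |v a - l|)) F (nhds 0) := by
    simpa using ((tendsto_iff_norm_sub_tendsto_zero.1 hu).add
      (tendsto_iff_norm_sub_tendsto_zero.1 hv)).const_mul C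
  exact squeeze_zero' (.of_forall fun _ => norm_nonneg _)
    (hv₀.mono fun a ha => hC (u a) y (v a) l ha hl) hbound

theorem tendsto_corr : Filter.Tendsto (fun a => corr X (u a) (v a)) F (nhds (corr X y l)) :=
  ((continuous_score X).tendsto (y, coef X y l)).comp (f := fun a => (u a, coef X (u a) (v a)))
    (hu.prodMk_nhds (tendsto_coef hX hl hu hv hv₀))

theorem eventually_forall_mem_active_sgn_eq :
    ∀ᶠ a in F, ∀ j ∈ active X y l, sgn X (u a) (v a) j = sgn X y l j := by
  refine (Filter.eventually_all_finset _).2 fun j hj => ?_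
  exact ((tendsto_pi_nhds.1 (tendsto_coef hX hl hu hv hv₀)) j).eventually
    (eventually_real_sign_eq (mem_active.1 hj))

theorem eventually_active_subset : ∀ᶠ a in F, active X y l ⊆ active X (u a) (v a) := by
  filter_upwards [eventually_forall_mem_active_sgn_eq hX hl hu hv hv₀] with a ha j hj
  by_contra hja
  exact sgn_eq_zero_iff.1 ((ha j hj).symm.trans (sgn_eq_zero_iff.2 hja)) hj

theorem eventually_equi_subset : ∀ᶠ a in F, equi X (u a) (v a) ⊆ equi X y l := by
  have hne : ∀ᶠ a in F, ∀ j, j ∉ equi X y l → |corr X (u a) (v a) j| ≠ v a := by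
    refine Filter.eventually_all.2 fun j => ?_
    by_cases hj : j ∈ equi X y l
    · simp [hj]
    · have hj' : |corr X y l j| - l ≠ 0 := sub_ne_zero.2 (mt mem_equi.2 hj)
      filter_upwards [(((tendsto_pi_nhds.1 (tendsto_corr hX hl hu hv hv₀)) j).abs.sub
        hv).eventually_ne hj'] with a ha _
      exact sub_ne_zero.1 ha
  filter_upwards [hne] with a ha j hj
  by_contra hj'
  exact ha j hj' (mem_equi.1 hj)

end Continuity

theorem continuousOn_coef (y : Fin n → ℝ) : ContinuousOn (coef X y) (Set.Ici 0) := fun _ hl =>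
  tendsto_coef hX hl tendsto_const_nhds nhdsWithin_le_nhds self_mem_nhdsWithin

theorem continuousOn_corr (y : Fin n → ℝ) : ContinuousOn (corr X y) (Set.Ici 0) := fun _ hl =>
  tendsto_corr hX hl tendsto_const_nhds nhdsWithin_le_nhds self_mem_nhdsWithin

end

end

/-! ### Transition points -/

section

variable {n p : ℕ} {X : Matrix (Fin n) (Fin p) ℝ}

section TransitionPoints

theorem zero_mem_transitionPoints (X : Matrix (Fin n) (Fin p) ℝ) (y : Fin n → ℝ) :
    (0 : ℝ) ∈ transitionPoints X y := Or.inl rfl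

theorem nonneg_of_mem_transitionPoints {y : Fin n → ℝ} {l : ℝ} (h : l ∈ transitionPoints X y) :
    0 ≤ l := h.elim (fun h => h.ge) fun h => h.1.le

variable (hX : LinearIndependent ℝ X.col)
include hX

/-- A transition point is an end point of one of the intervals on which the sign vector takes a
given value, and there are finitely many sign vectors. -/
theorem finite_transitionPoints (y : Fin n → ℝ) : (transitionPoints X y).Finite := by
  let I : (Fin p → SignType) → Set ℝ := fun s => {l | 0 ≤ l ∧ sgn X y l = fun j => (s j : ℝ)}
  refine (((Set.finite_singleton (0 : ℝ)).union (Set.finite_range fun s => sInf (I s))).union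
    (Set.finite_range fun s => sSup (I s))).subset ?_
  rintro l (rfl | ⟨hl, hnot⟩)
  · exact Or.inl (Or.inl rfl)
  set s : Fin p → SignType := fun j => SignType.sign (coef X y l j)
  have hmem : l ∈ I s := ⟨hl.le, funext fun j => real_sign_eq_coe_sign _⟩
  by_contra! h
  simp only [Set.mem_union, Set.mem_range, not_or, not_exists] at h
  refine hnot ?_
  filter_upwards [mem_nhds_of_ordConnected (convex_setOf_sgn_eq hX y _).ordConnected hmem
    (fun heq => h.1.2 s heq.symm) (fun heq => h.2 s heq.symm)] with l' hl'
  exact active_congr (hl'.2.trans hmem.2.symm)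

theorem eventually_sgn_eq {y : Fin n → ℝ} {l : ℝ} (hl : 0 < l) (h : l ∉ transitionPoints X y) :
    ∀ᶠ l' in nhds l, sgn X y l' = sgn X y l := by
  have hactive : ∀ᶠ l' in nhds l, active X y l' = active X y l := by
    by_contra h'
    exact h (Or.inr ⟨hl, h'⟩)
  filter_upwards [hactive, eventually_forall_mem_active_sgn_eq hX hl.le tendsto_const_nhds
    Filter.tendsto_id ((lt_mem_nhds hl).mono fun _ => le_of_lt)] with l' hl' hsgn
  ext j
  by_cases hj : j ∈ active X y l
  · exact hsgn j hj
  · rw [sgn_eq_zero_iff.2 hj, sgn_eq_zero_iff.2 (hl' ▸ hj)]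

theorem sgn_eq_of_isPreconnected {y : Fin n → ℝ} {U : Set ℝ} (hU : IsPreconnected U)
    (hpos : ∀ l ∈ U, 0 < l) (h : ∀ l ∈ U, l ∉ transitionPoints X y) {a b : ℝ} (ha : a ∈ U)
    (hb : b ∈ U) : sgn X y a = sgn X y b :=
  hU.induction₂ (fun a b => sgn X y a = sgn X y b)
    (fun l hl => ((eventually_sgn_eq hX (hpos l hl) (h l hl)).filter_mono
      nhdsWithin_le_nhds).mono fun _ => Eq.symm)
    (fun _ _ _ _ _ _ => Eq.trans) (fun _ _ _ _ => Eq.symm) ha hb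

end TransitionPoints

section Knots

variable (hX : LinearIndependent ℝ X.col) (y : Fin n → ℝ)
include hX

theorem lastIndex_add_one :
    lastIndex X y + 1 = ((finite_transitionPoints hX y).toFinset.sort (· ≥ ·)).length := by
  rw [Finset.length_sort, lastIndex, Set.ncard_eq_toFinset_card _ (finite_transitionPoints hX y)]
  refine Nat.succ_pred_eq_of_pos (Finset.card_pos.2 ⟨0, ?_⟩)
  simpa using zero_mem_transitionPoints X y

theorem knot_eq_getElem {m : ℕ} (hm : m ≤ lastIndex X y) :
    knot X y m = ((finite_transitionPoints hX y).toFinset.sort (· ≥ ·))[m]'(by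
      rw [← lastIndex_add_one hX y]; omega) := by
  rw [knot, dif_pos (finite_transitionPoints hX y), List.getD_eq_getElem]

theorem knot_of_lastIndex_lt {m : ℕ} (hm : lastIndex X y < m) : knot X y m = 0 := by
  rw [knot, dif_pos (finite_transitionPoints hX y), List.getD_eq_default]
  rw [← lastIndex_add_one hX y]; omega

theorem knot_mem_transitionPoints (m : ℕ) : knot X y m ∈ transitionPoints X y := by
  rcases lt_or_ge (lastIndex X y) m with hm | hm
  · rw [knot_of_lastIndex_lt hX y hm]
    exact zero_mem_transitionPoints X y
  · rw [knot_eq_getElem hX y hm, ← (finite_transitionPoints hX y).mem_toFinset,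
      ← Finset.mem_sort (· ≥ ·)]
    exact List.getElem_mem _

theorem knot_lt {m m' : ℕ} (h : m < m') (hm : m' ≤ lastIndex X y) :
    knot X y m' < knot X y m := by
  rw [knot_eq_getElem hX y hm, knot_eq_getElem hX y (h.le.trans hm)]
  exact List.sortedGT_iff_getElem_gt_getElem_of_lt.1 (Finset.sortedGT_sort _) h

theorem exists_knot_eq {l : ℝ} (hl : l ∈ transitionPoints X y) :
    ∃ m ≤ lastIndex X y, knot X y m = l := by
  rw [← (finite_transitionPoints hX y).mem_toFinset, ← Finset.mem_sort (· ≥ ·)] at hl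
  obtain ⟨m, hm, h⟩ := List.getElem_of_mem hl
  have hm' : m ≤ lastIndex X y := by
    rw [← lastIndex_add_one hX y] at hm
    omega
  exact ⟨m, hm', by rw [knot_eq_getElem hX y hm', h]⟩

theorem knot_nonneg (m : ℕ) : 0 ≤ knot X y m :=
  nonneg_of_mem_transitionPoints (knot_mem_transitionPoints hX y m)

theorem knot_antitone : Antitone (knot X y) := by
  intro m m' h
  rcases h.eq_or_lt with rfl | hlt
  · exact le_rfl
  rcases le_or_gt m' (lastIndex X y) with hm' | hm'
  · exact (knot_lt hX y hlt hm').le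
  · rw [knot_of_lastIndex_lt hX y hm']
    exact knot_nonneg hX y m

theorem knot_of_lastIndex_le {m : ℕ} (hm : lastIndex X y ≤ m) : knot X y m = 0 := by
  obtain ⟨m₀, hm₀, h⟩ := exists_knot_eq hX y (zero_mem_transitionPoints X y)
  exact le_antisymm (h ▸ knot_antitone hX y (hm₀.trans hm)) (knot_nonneg hX y m)

theorem notMem_transitionPoints_of_mem_Ioo {m : ℕ} {l : ℝ}
    (hl : l ∈ Set.Ioo (knot X y (m + 1)) (knot X y m)) : l ∉ transitionPoints X y := by
  intro h
  obtain ⟨m', -, rfl⟩ := exists_knot_eq hX y h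
  rcases le_or_gt m' m with hm' | hm'
  · exact (knot_antitone hX y hm').not_gt hl.2
  · exact (knot_antitone hX y (Nat.succ_le_of_lt hm')).not_gt hl.1

theorem notMem_transitionPoints_of_knot_zero_lt {l : ℝ} (hl : knot X y 0 < l) :
    l ∉ transitionPoints X y := by
  intro h
  obtain ⟨m', -, rfl⟩ := exists_knot_eq hX y h
  exact (knot_antitone hX y (Nat.zero_le _)).not_gt hl

theorem midpt_mem_Ioo {m : ℕ} (hm : m < lastIndex X y) :
    midpt X y m ∈ Set.Ioo (knot X y (m + 1)) (knot X y m) := by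
  have := knot_lt hX y (Nat.lt_succ_self m) hm
  constructor <;> rw [midpt] <;> linarith

theorem sgn_eq_intervalSgn {m : ℕ} {l : ℝ}
    (hl : l ∈ Set.Ioo (knot X y (m + 1)) (knot X y m)) : sgn X y l = intervalSgn X y m := by
  have hm : m < lastIndex X y := by
    by_contra! hm
    rw [knot_of_lastIndex_le hX y hm] at hl
    exact ((knot_nonneg hX y _).trans_lt hl.1).not_gt hl.2
  exact sgn_eq_of_isPreconnected hX isPreconnected_Ioo
    (fun _ h => (knot_nonneg hX y _).trans_lt h.1)
    (fun _ h => notMem_transitionPoints_of_mem_Ioo hX y h) hl (midpt_mem_Ioo hX y hm)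

theorem active_eq_intervalActive {m : ℕ} {l : ℝ}
    (hl : l ∈ Set.Ioo (knot X y (m + 1)) (knot X y m)) : active X y l = intervalActive X y m :=
  active_congr (sgn_eq_intervalSgn hX y hl)

theorem coef_eq_zero_of_norm_score_le {l : ℝ} (hl : ‖score X y 0‖ ≤ l) : coef X y l = 0 :=
  KKT.coef_eq hX ((norm_nonneg _).trans hl)
    fun j => ⟨(norm_le_pi_norm (score X y 0) j).trans hl, by simp⟩

theorem active_of_knot_zero_lt {l : ℝ} (hl : knot X y 0 < l) : active X y l = ∅ := by
  set L := max ‖score X y 0‖ l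
  have hL : coef X y L = 0 := coef_eq_zero_of_norm_score_le hX y (le_max_left _ _)
  rw [active_congr (sgn_eq_of_isPreconnected hX isPreconnected_Ioi
    (fun _ h => (knot_nonneg hX y 0).trans_lt h)
    (fun _ h => notMem_transitionPoints_of_knot_zero_lt hX y h) hl
    (show L ∈ Set.Ioi (knot X y 0) from hl.trans_le (le_max_right _ _)))]
  simp [active, hL]

theorem coef_eq_zero_of_knot_zero_lt {l : ℝ} (hl : knot X y 0 < l) : coef X y l = 0 := by
  ext j
  by_contra hj
  have := mem_active.2 hj
  simp [active_of_knot_zero_lt hX y hl] at this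

theorem active_knot_zero : active X y (knot X y 0) = ∅ := by
  have hev : ∀ᶠ l in nhdsWithin (knot X y 0) (Set.Ioi (knot X y 0)),
      active X y (knot X y 0) ⊆ active X y l :=
    eventually_active_subset hX (knot_nonneg hX y 0) tendsto_const_nhds nhdsWithin_le_nhds
      (Filter.eventually_of_mem self_mem_nhdsWithin fun _ hl => (knot_nonneg hX y 0).trans hl.le)
  obtain ⟨l, hsub, hl⟩ := (hev.and self_mem_nhdsWithin).exists
  exact Finset.subset_empty.1 (active_of_knot_zero_lt hX y hl ▸ hsub)

theorem active_knot_succ_subset {m : ℕ} (hm : m < lastIndex X y) :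
    active X y (knot X y (m + 1)) ⊆ intervalActive X y m := by
  have hlt := knot_lt hX y (Nat.lt_succ_self m) hm
  have hev : ∀ᶠ l in nhdsWithin (knot X y (m + 1)) (Set.Ioi (knot X y (m + 1))),
      active X y (knot X y (m + 1)) ⊆ active X y l :=
    eventually_active_subset hX (knot_nonneg hX y _) tendsto_const_nhds nhdsWithin_le_nhds
      (Filter.eventually_of_mem self_mem_nhdsWithin fun _ hl => (knot_nonneg hX y _).trans hl.le)
  obtain ⟨l, hsub, hl⟩ := (hev.and (Ioo_mem_nhdsGT hlt)).exists
  rwa [active_eq_intervalActive hX y hl] at hsub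

theorem midpt_of_lastIndex_le {m : ℕ} (hm : lastIndex X y ≤ m) : midpt X y m = 0 := by
  rw [midpt, knot_of_lastIndex_le hX y hm, knot_of_lastIndex_le hX y (hm.trans m.le_succ)]
  simp

theorem joining_of_lastIndex_le {m : ℕ} (hm : lastIndex X y ≤ m) : joining X y m = ∅ := by
  rw [joining, intervalActive, midpt_of_lastIndex_le hX y hm, knot_of_lastIndex_le hX y hm,
    sdiff_self, Finset.bot_eq_empty]

theorem leaving_of_lastIndex_le {m : ℕ} (hm : lastIndex X y ≤ m) : leaving X y m = ∅ := by
  rw [leaving, intervalActive, midpt_of_lastIndex_le hX y hm,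
    knot_of_lastIndex_le hX y (hm.trans m.le_succ), sdiff_self, Finset.bot_eq_empty]

end Knots

end

/-! ### The fit at a transition point -/

section

variable {n p : ℕ} {X : Matrix (Fin n) (Fin p) ℝ}

/-- Extension by zero of a vector indexed by a set of predictors. -/
def extend (A : Finset (Fin p)) (c : A → ℝ) (j : Fin p) : ℝ :=
  if h : j ∈ A then c ⟨j, h⟩ else 0

@[simp]
theorem extend_coe (A : Finset (Fin p)) (c : A → ℝ) (j : A) : extend A c j = c j := by
  simp [extend]

theorem extend_of_notMem {A : Finset (Fin p)} (c : A → ℝ) {j : Fin p} (hj : j ∉ A) :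
    extend A c j = 0 := dif_neg hj

theorem extend_restrict {A : Finset (Fin p)} {b : Fin p → ℝ} (hb : ∀ j ∉ A, b j = 0) :
    extend A (fun j => b j) = b := by
  ext j
  by_cases hj : j ∈ A
  · exact dif_pos hj
  · rw [extend_of_notMem _ hj, hb j hj]

theorem cols_mulVec (X : Matrix (Fin n) (Fin p) ℝ) (A : Finset (Fin p)) (c : A → ℝ) :
    cols X A *ᵥ c = X *ᵥ extend A c := by
  ext i
  simp only [Matrix.mulVec, dotProduct, cols, Matrix.submatrix_apply, id]
  rw [← Finset.sum_subset (Finset.subset_univ A)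
    (fun j _ hj => by rw [extend_of_notMem c hj, mul_zero]),
    ← Finset.sum_coe_sort A fun j => X i j * extend A c j]
  simp only [extend_coe]

section Projection

theorem transpose_hat (X : Matrix (Fin n) (Fin p) ℝ) (A : Finset (Fin p)) :
    (hat X A)ᵀ = hat X A := by
  simp only [hat, Matrix.transpose_mul, Matrix.transpose_transpose, Matrix.transpose_nonsing_inv,
    Matrix.mul_assoc]

variable (hX : LinearIndependent ℝ X.col) (A : Finset (Fin p))
include hX

theorem mulVec_cols_injective : Function.Injective (cols X A).mulVec := by
  intro b c hbc
  rw [cols_mulVec, cols_mulVec] at hbc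
  ext j
  simpa using congrFun (Matrix.mulVec_injective_iff.2 hX hbc) j

theorem isUnit_det_gram : IsUnit ((cols X A)ᵀ * cols X A).det := by
  have hpos := Matrix.PosDef.conjTranspose_mul_self _ (mulVec_cols_injective hX A)
  rw [Matrix.conjTranspose_eq_transpose_of_trivial] at hpos
  exact (Matrix.isUnit_iff_isUnit_det _).1 hpos.isUnit

theorem hat_mul_cols : hat X A * cols X A = cols X A := by
  rw [hat, Matrix.mul_assoc, Matrix.mul_assoc, Matrix.nonsing_inv_mul _ (isUnit_det_gram hX A),
    Matrix.mul_one]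

theorem trace_hat : (hat X A).trace = A.card := by
  rw [hat, Matrix.mul_assoc, Matrix.trace_mul_comm, Matrix.mul_assoc,
    Matrix.nonsing_inv_mul _ (isUnit_det_gram hX A), Matrix.trace_one, Fintype.card_coe]

variable {A}

theorem eq_zero_of_vecMul_one_sub_hat_eq_zero {v : Fin p → ℝ}
    (hv : (X *ᵥ v) ᵥ* (1 - hat X A) = 0) {i : Fin p} (hi : i ∉ A) : v i = 0 := by
  rw [← Matrix.mulVec_transpose, Matrix.transpose_sub, Matrix.transpose_one, transpose_hat,
    Matrix.sub_mulVec, Matrix.one_mulVec, sub_eq_zero, hat, Matrix.mul_assoc,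
    ← Matrix.mulVec_mulVec, cols_mulVec] at hv
  rw [Matrix.mulVec_injective_iff.2 hX hv, extend_of_notMem _ hi]

end Projection

/-- The vector `X_A (X_Aᵀ X_A)⁻¹ s_A`. -/
def dir (X : Matrix (Fin n) (Fin p) ℝ) (A : Finset (Fin p)) (s : Fin p → ℝ) : Fin n → ℝ :=
  cols X A *ᵥ (((cols X A)ᵀ * cols X A)⁻¹ *ᵥ fun j => s j)

/-- The residual of the predictor `i` after projection onto the predictors in `A`. -/
def resid (X : Matrix (Fin n) (Fin p) ℝ) (A : Finset (Fin p)) (i : Fin p) : Fin n → ℝ :=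
  X.col i ᵥ* (1 - hat X A)

/-- The scalar `e - x_iᵀ X_A (X_Aᵀ X_A)⁻¹ s_A`, where `e` stands for the sign of the predictor
`i`. -/
def denom (X : Matrix (Fin n) (Fin p) ℝ) (A : Finset (Fin p)) (s : Fin p → ℝ) (e : ℝ)
    (i : Fin p) : ℝ :=
  e - X.col i ⬝ᵥ dir X A s

/-- The matrix mapping the response to the fit at which the predictor `i` joins the active set `A`
with sign vector `s`, the sign of `i` being `e`. -/
def selector (X : Matrix (Fin n) (Fin p) ℝ) (A : Finset (Fin p)) (s : Fin p → ℝ) (e : ℝ)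
    (i : Fin p) : Matrix (Fin n) (Fin n) ℝ :=
  hat X A - (1 / denom X A s e i) • Matrix.vecMulVec (dir X A s) (resid X A i)

theorem stepDenom_eq_denom (X : Matrix (Fin n) (Fin p) ℝ) (y : Fin n → ℝ) (m : ℕ) (i : Fin p) :
    stepDenom X y m i = denom X (active X y (knot X y m)) (sgn X y (knot X y m))
      (intervalSgn X y m i) i := rfl

theorem stepMatrix_eq_selector (X : Matrix (Fin n) (Fin p) ℝ) (y : Fin n → ℝ) (m : ℕ)
    (i : Fin p) :
    stepMatrix X y m i = selector X (active X y (knot X y m)) (sgn X y (knot X y m))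
      (intervalSgn X y m i) i := rfl

theorem resid_dotProduct (X : Matrix (Fin n) (Fin p) ℝ) (A : Finset (Fin p)) (i : Fin p)
    (y : Fin n → ℝ) : resid X A i ⬝ᵥ y = X.col i ⬝ᵥ (y - hat X A *ᵥ y) := by
  rw [resid, ← Matrix.dotProduct_mulVec, Matrix.sub_mulVec, Matrix.one_mulVec]

section Fit

variable (hX : LinearIndependent ℝ X.col)
include hX

theorem resid_dotProduct_dir (A : Finset (Fin p)) (s : Fin p → ℝ) (i : Fin p) :
    resid X A i ⬝ᵥ dir X A s = 0 := by
  rw [resid_dotProduct, dir, Matrix.mulVec_mulVec (M := hat X A), hat_mul_cols hX, sub_self,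
    dotProduct_zero]

theorem trace_selector (A : Finset (Fin p)) (s : Fin p → ℝ) (e : ℝ) (i : Fin p) :
    (selector X A s e i).trace = A.card := by
  rw [selector, Matrix.trace_sub, Matrix.trace_smul, Matrix.trace_vecMulVec, dotProduct_comm,
    resid_dotProduct_dir hX, trace_hat hX, smul_zero, sub_zero]

theorem fit_eq_hat_mulVec_sub (y : Fin n → ℝ) {l : ℝ} (hl : 0 ≤ l) :
    fit X y l = hat X (active X y l) *ᵥ y - (l / 2) • dir X (active X y l) (sgn X y l) := by
  set A := active X y l with hA
  set r := y - fit X y l with hr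
  have hfit : hat X A *ᵥ fit X y l = fit X y l := by
    have hsupp : extend A (fun j => coef X y l j) = coef X y l :=
      extend_restrict fun j hj => by simpa [hA] using hj
    rw [fit, ← hsupp, ← cols_mulVec, Matrix.mulVec_mulVec, hat_mul_cols hX]
  have hresidual : (cols X A)ᵀ *ᵥ r = (l / 2) • fun j : A => sgn X y l j := by
    ext j
    have hcorr : 2 * ((cols X A)ᵀ *ᵥ r) j = l * sgn X y l j := corr_of_mem_active hX hl j.2
    rw [Pi.smul_apply, smul_eq_mul]
    linarith
  have hproj : hat X A *ᵥ r = (l / 2) • dir X A (sgn X y l) := by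
    rw [hat, ← Matrix.mulVec_mulVec, hresidual, dir, Matrix.mulVec_smul, Matrix.mulVec_mulVec]
  rw [← hproj, hr, Matrix.mulVec_sub, hfit, sub_sub_cancel]

theorem resid_dotProduct_eq_mul_denom (y : Fin n → ℝ) {l : ℝ} (hl : 0 ≤ l) {i : Fin p} {e : ℝ}
    (hi : corr X y l i = l * e) :
    resid X (active X y l) i ⬝ᵥ y = l / 2 * denom X (active X y l) (sgn X y l) e i := by
  have hcorr : corr X y l i = 2 * (X.col i ⬝ᵥ (y - fit X y l)) := rfl
  rw [hi, fit_eq_hat_mulVec_sub hX y hl, ← sub_add, dotProduct_add, ← resid_dotProduct,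
    dotProduct_smul, smul_eq_mul] at hcorr
  rw [denom]
  linarith

/-- The identity `resid_dotProduct_eq_mul_denom` expresses `l` through `y`; this turns the affine
formula `fit_eq_hat_mulVec_sub` into a linear one. -/
theorem fit_eq_selector_mulVec (y : Fin n → ℝ) {l : ℝ} (hl : 0 ≤ l) {i : Fin p} {e : ℝ}
    (hi : corr X y l i = l * e) (hd : denom X (active X y l) (sgn X y l) e i ≠ 0) :
    fit X y l = selector X (active X y l) (sgn X y l) e i *ᵥ y := by
  rw [selector, Matrix.sub_mulVec, Matrix.smul_mulVec, Matrix.vecMulVec_mulVec,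
    fit_eq_hat_mulVec_sub hX y hl, resid_dotProduct_eq_mul_denom hX y hl hi, op_smul_eq_smul,
    smul_smul, one_div, mul_comm (l / 2), inv_mul_cancel_left₀ hd]

theorem corr_of_mem_intervalActive (y : Fin n → ℝ) {m : ℕ} (hm : m < lastIndex X y) {i : Fin p}
    (hi : i ∈ intervalActive X y m) {l : ℝ} (hl : l ∈ Set.Icc (knot X y (m + 1)) (knot X y m)) :
    corr X y l i = l * intervalSgn X y m i := by
  have hlt := knot_lt hX y (Nat.lt_succ_self m) hm
  have hnonneg := knot_nonneg hX y (m + 1)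
  have hIoo : Set.EqOn (fun l => corr X y l i) (fun l => l * intervalSgn X y m i)
      (Set.Ioo (knot X y (m + 1)) (knot X y m)) := fun l hl => by
    have hi' : i ∈ active X y l := by rwa [active_eq_intervalActive hX y hl]
    rw [← sgn_eq_intervalSgn hX y hl]
    exact corr_of_mem_active hX (hnonneg.trans hl.1.le) hi'
  have hcont : ContinuousOn (fun l => corr X y l i) (Set.Icc (knot X y (m + 1)) (knot X y m)) :=
    (continuousOn_pi.1 (continuousOn_corr hX y) i).mono fun l hl => hnonneg.trans hl.1
  exact hIoo.of_subset_closure hcont (by fun_prop) Set.Ioo_subset_Icc_self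
    (closure_Ioo hlt.ne).ge hl

theorem corr_of_mem_joining {y : Fin n → ℝ} {m : ℕ} {i : Fin p} (hi : i ∈ joining X y m) :
    corr X y (knot X y m) i = knot X y m * intervalSgn X y m i := by
  have hm : m < lastIndex X y := by
    by_contra! hm
    simp [joining_of_lastIndex_le hX y hm] at hi
  exact corr_of_mem_intervalActive hX y hm (Finset.mem_sdiff.1 hi).1
    (Set.right_mem_Icc.2 (knot_antitone hX y m.le_succ))

theorem corr_of_mem_leaving {y : Fin n → ℝ} {m : ℕ} {i : Fin p} (hi : i ∈ leaving X y m) :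
    corr X y (knot X y (m + 1)) i = knot X y (m + 1) * intervalSgn X y m i := by
  have hm : m < lastIndex X y := by
    by_contra! hm
    simp [leaving_of_lastIndex_le hX y hm] at hi
  exact corr_of_mem_intervalActive hX y hm (Finset.mem_sdiff.1 hi).1
    (Set.left_mem_Icc.2 (knot_antitone hX y m.le_succ))

end Fit

end

/-! ### One predictor at a time -/

section

variable {n p : ℕ} {X : Matrix (Fin n) (Fin p) ℝ}

open Classical in
/-- Normal vectors of finitely many hyperplanes outside which only one predictor at a time joins or
leaves the active set. Either two predictors `i` and `i'` outside `A` with given signs, or the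
predictor `i` at `l = 0`, put the response on one of them. -/
def normals (X : Matrix (Fin n) (Fin p) ℝ) : Finset (Fin n → ℝ) :=
  ((Finset.univ.image fun q : Finset (Fin p) × Fin p => resid X q.1 q.2) ∪
    (Finset.univ.image fun q :
        Finset (Fin p) × (Fin p → SignType) × (Fin p × SignType) × Fin p × SignType =>
      let (A, s, (i, e), i', e') := q
      denom X A (fun j => s j) e' i' • resid X A i -
        denom X A (fun j => s j) e i • resid X A i')).filter (· ≠ 0)

theorem ne_zero_of_mem_normals {a : Fin n → ℝ} (ha : a ∈ normals X) : a ≠ 0 := by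
  unfold normals at ha
  exact (Finset.mem_filter.1 ha).2

/-- The response lies on none of the exceptional hyperplanes. -/
def Generic (X : Matrix (Fin n) (Fin p) ℝ) (y : Fin n → ℝ) : Prop :=
  ∀ a ∈ normals X, a ⬝ᵥ y ≠ 0

variable (hX : LinearIndependent ℝ X.col)
include hX

theorem resid_ne_zero {A : Finset (Fin p)} {i : Fin p} (hi : i ∉ A) : resid X A i ≠ 0 := by
  intro h
  rw [resid, ← Matrix.mulVec_single_one] at h
  simpa using eq_zero_of_vecMul_one_sub_hat_eq_zero hX h hi

theorem smul_resid_sub_smul_resid_ne_zero {A : Finset (Fin p)} {i i' : Fin p} (hi : i ∉ A)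
    (hne : i ≠ i') {c : ℝ} (hc : c ≠ 0) (c' : ℝ) : c • resid X A i - c' • resid X A i' ≠ 0 := by
  intro h
  rw [resid, resid, ← Matrix.smul_vecMul, ← Matrix.smul_vecMul, ← Matrix.sub_vecMul,
    ← Matrix.mulVec_single_one, ← Matrix.mulVec_single_one, ← Matrix.mulVec_smul,
    ← Matrix.mulVec_smul, ← Matrix.mulVec_sub] at h
  have hzero := eq_zero_of_vecMul_one_sub_hat_eq_zero hX h hi
  exact hc (by simpa [hne] using hzero)

namespace Generic

variable {y : Fin n → ℝ} (hy : Generic X y)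
include hy

theorem resid_dotProduct_ne_zero {A : Finset (Fin p)} {i : Fin p} (hi : i ∉ A) :
    resid X A i ⬝ᵥ y ≠ 0 := by
  classical
  exact hy _ (Finset.mem_filter.2 ⟨Finset.mem_union_left _ (Finset.mem_image.2
    ⟨(A, i), Finset.mem_univ _, rfl⟩), resid_ne_zero hX hi⟩)

theorem half_mul_denom_ne_zero {l : ℝ} (hl : 0 ≤ l) {i : Fin p} (hi : i ∉ active X y l) {e : ℝ}
    (he : corr X y l i = l * e) : l / 2 * denom X (active X y l) (sgn X y l) e i ≠ 0 := by
  rw [← resid_dotProduct_eq_mul_denom hX y hl he]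
  exact hy.resid_dotProduct_ne_zero hX hi

theorem eq_of_corr_eq {l : ℝ} (hl : 0 ≤ l) {i i' : Fin p} (hi : i ∉ active X y l)
    (hi' : i' ∉ active X y l) {e e' : SignType} (he : corr X y l i = l * e)
    (he' : corr X y l i' = l * e') : i = i' := by
  classical
  by_contra hne
  set A := active X y l
  set s : Fin p → SignType := fun j => SignType.sign (coef X y l j)
  have hs : sgn X y l = fun j => (s j : ℝ) := funext fun j => real_sign_eq_coe_sign _
  have hd := right_ne_zero_of_mul (hy.half_mul_denom_ne_zero hX hl hi' he')
  have hr := resid_dotProduct_eq_mul_denom hX y hl he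
  have hr' := resid_dotProduct_eq_mul_denom hX y hl he'
  rw [hs] at hd hr hr'
  refine hy _ (Finset.mem_filter.2 ⟨Finset.mem_union_right _ (Finset.mem_image.2
    ⟨(A, s, (i, e), i', e'), Finset.mem_univ _, rfl⟩),
    smul_resid_sub_smul_resid_ne_zero hX hi hne hd _⟩) ?_
  rw [sub_dotProduct, smul_dotProduct, smul_dotProduct, hr, hr', smul_eq_mul, smul_eq_mul]
  ring

theorem card_le_one {l : ℝ} (hl : 0 ≤ l) (b : Fin p → ℝ) {W : Finset (Fin p)}
    (hW : ∀ i ∈ W, i ∉ active X y l ∧ corr X y l i = l * Real.sign (b i)) : W.card ≤ 1 := by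
  simp only [real_sign_eq_coe_sign] at hW
  exact Finset.card_le_one.2 fun i hi i' hi' =>
    hy.eq_of_corr_eq hX hl (hW i hi).1 (hW i' hi').1 (hW i hi).2 (hW i' hi').2

theorem card_joining_le_one (m : ℕ) : (joining X y m).card ≤ 1 :=
  hy.card_le_one hX (knot_nonneg hX y m) _ fun _ hi =>
    ⟨(Finset.mem_sdiff.1 hi).2, corr_of_mem_joining hX hi⟩

theorem card_leaving_le_one (m : ℕ) : (leaving X y m).card ≤ 1 :=
  hy.card_le_one hX (knot_nonneg hX y (m + 1)) _ fun _ hi =>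
    ⟨(Finset.mem_sdiff.1 hi).2, corr_of_mem_leaving hX hi⟩

theorem stepDenom_ne_zero {m : ℕ} {i : Fin p} (hi : i ∈ joining X y m) :
    stepDenom X y m i ≠ 0 :=
  right_ne_zero_of_mul (hy.half_mul_denom_ne_zero hX (knot_nonneg hX y m) (Finset.mem_sdiff.1 hi).2
    (corr_of_mem_joining hX hi))

theorem active_zero : active X y 0 = Finset.univ := by
  refine Finset.eq_univ_iff_forall.2 fun i => ?_
  by_contra hi
  have hcorr : corr X y 0 i = 0 * 0 := by
    simpa using abs_corr_le hX y le_rfl i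
  exact hy.half_mul_denom_ne_zero hX le_rfl hi hcorr (by simp)

theorem card_active_knot_succ_le {m : ℕ} (hm : m < lastIndex X y) :
    (active X y (knot X y (m + 1))).card ≤ (active X y (knot X y m)).card + 1 := by
  calc (active X y (knot X y (m + 1))).card ≤ (intervalActive X y m).card :=
        Finset.card_le_card (active_knot_succ_subset hX y hm)
    _ ≤ (joining X y m).card + (active X y (knot X y m)).card :=
        Finset.card_le_card_sdiff_add_card
    _ ≤ _ := by linarith [hy.card_joining_le_one hX m]

/-- The number of active predictors grows from `0` to `p` along the knots, in steps of at most
one. -/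
theorem stepsWith_nonempty {k : ℕ} (hk : k ≤ p) : (stepsWith X y k).Nonempty := by
  classical
  have hlast : k ≤ (active X y (knot X y (lastIndex X y))).card := by
    rwa [knot_of_lastIndex_le hX y le_rfl, hy.active_zero hX, Finset.card_univ, Fintype.card_fin]
  have hex : ∃ m, k ≤ (active X y (knot X y m)).card := ⟨_, hlast⟩
  have hle : Nat.find hex ≤ lastIndex X y := Nat.find_min' hex hlast
  refine ⟨Nat.find hex, hle, le_antisymm ?_ (Nat.find_spec hex)⟩
  rcases hfind : Nat.find hex with _ | m
  · simp [active_knot_zero hX y]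
  · have hm := Nat.find_min hex (m := m) (by omega)
    have hstep := hy.card_active_knot_succ_le hX (m := m) (by omega)
    omega

end Generic

end

/-! ### The positive cone condition -/

section

variable {n p : ℕ} {X : Matrix (Fin n) (Fin p) ℝ}

/-- The coefficient vector, supported on `A`, of the combination of the predictors in `A` whose
inner product with each of these predictors `j` is `s j`. -/
def gramSolve (X : Matrix (Fin n) (Fin p) ℝ) (A : Finset (Fin p)) (s : Fin p → ℝ) : Fin p → ℝ :=
  extend A (((cols X A)ᵀ * cols X A)⁻¹ *ᵥ fun j => s j)

/-- The direction in which the coefficients leave `coef X y l` as the regularization parameter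
decreases from `l`, if the positive cone condition holds. -/
def pathDir (X : Matrix (Fin n) (Fin p) ℝ) (y : Fin n → ℝ) (l : ℝ) : Fin p → ℝ :=
  gramSolve X (equi X y l) (l⁻¹ • corr X y l)

theorem gramSolve_of_notMem (X : Matrix (Fin n) (Fin p) ℝ) {A : Finset (Fin p)} (s : Fin p → ℝ)
    {j : Fin p} (hj : j ∉ A) : gramSolve X A s j = 0 :=
  extend_of_notMem _ hj

theorem gramSolve_congr {A : Finset (Fin p)} {s s' : Fin p → ℝ} (h : ∀ j ∈ A, s j = s' j) :
    gramSolve X A s = gramSolve X A s' := by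
  rw [gramSolve, gramSolve, funext fun j : A => h j j.2]

theorem transpose_mulVec_mulVec_gramSolve (hX : LinearIndependent ℝ X.col) {A : Finset (Fin p)}
    (s : Fin p → ℝ) {j : Fin p} (hj : j ∈ A) : (Xᵀ *ᵥ (X *ᵥ gramSolve X A s)) j = s j := by
  have h : (cols X A)ᵀ *ᵥ (X *ᵥ gramSolve X A s) = fun j : A => s j := by
    rw [gramSolve, ← cols_mulVec, Matrix.mulVec_mulVec, Matrix.mulVec_mulVec,
      Matrix.mul_nonsing_inv _ (isUnit_det_gram hX A), Matrix.one_mulVec]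
  exact congrFun h ⟨j, hj⟩

theorem score_add_half_smul (X : Matrix (Fin n) (Fin p) ℝ) (y : Fin n → ℝ) (b e : Fin p → ℝ)
    (δ : ℝ) (j : Fin p) :
    score X y (b + (δ / 2) • e) j = score X y b j - δ * (Xᵀ *ᵥ (X *ᵥ e)) j := by
  rw [score, score, Matrix.mulVec_add, ← sub_sub, Matrix.mulVec_sub, Matrix.mulVec_smul,
    Matrix.mulVec_smul]
  simp only [Pi.smul_apply, Pi.sub_apply, smul_eq_mul]
  ring

theorem eventually_abs_corr_sub_lt (hX : LinearIndependent ℝ X.col) (y : Fin n → ℝ) {l : ℝ}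
    (hl : 0 ≤ l) (g : Fin p → ℝ) :
    ∀ᶠ δ in nhds (0 : ℝ), ∀ j ∉ equi X y l, |corr X y l j - δ * g j| < l - δ := by
  refine Filter.eventually_all.2 fun j => ?_
  by_cases hj : j ∈ equi X y l
  · simp [hj]
  have hlt : |corr X y l j| < l := (abs_corr_le hX y hl j).lt_of_ne (mt mem_equi.2 hj)
  have hcont : ContinuousAt (fun δ : ℝ => l - δ - |corr X y l j - δ * g j|) 0 := by fun_prop
  filter_upwards [hcont.eventually_const_lt (u := 0) (by simpa using hlt)] with δ hδ _
  linarith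

namespace PositiveCone

variable (hpc : PositiveCone X)
include hpc

theorem mul_inv_gram_mulVec_pos {A : Finset (Fin p)} {s : Fin p → ℝ}
    (hs : ∀ j, s j = 1 ∨ s j = -1) (i : A) :
    0 < s i * (((cols X A)ᵀ * cols X A)⁻¹ *ᵥ fun j => s j) i := by
  set D : Matrix A A ℝ := Matrix.diagonal fun j => s j with hD
  have hcols : cols (X * Matrix.diagonal s) A = cols X A * D := by
    ext a b
    simp [cols, hD, Matrix.mul_diagonal]
  have hinv : D⁻¹ = D := by
    refine Matrix.inv_eq_left_inv ?_
    rw [hD, Matrix.diagonal_mul_diagonal, ← Matrix.diagonal_one]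
    congr 1
    ext j
    rcases hs j with h | h <;> simp [h]
  have hone : D *ᵥ 1 = fun j : A => s j := by
    ext j
    simp [hD, Matrix.mulVec_diagonal]
  have h := hpc A s hs i
  rwa [hcols, Matrix.transpose_mul, Matrix.diagonal_transpose, Matrix.mul_assoc,
    ← Matrix.mul_assoc (cols X A)ᵀ, Matrix.mul_inv_rev, Matrix.mul_inv_rev, hinv,
    ← Matrix.mulVec_mulVec, ← Matrix.mulVec_mulVec, hone, hD, Matrix.mulVec_diagonal] at h

theorem mul_gramSolve_pos {A : Finset (Fin p)} {s : Fin p → ℝ}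
    (hs : ∀ j ∈ A, s j = 1 ∨ s j = -1) {j : Fin p} (hj : j ∈ A) :
    0 < s j * gramSolve X A s j := by
  classical
  set s' : Fin p → ℝ := fun j => if j ∈ A then s j else 1
  have hs' : ∀ j ∈ A, s j = s' j := fun j hj => (if_pos hj).symm
  have hsigns : ∀ j, s' j = 1 ∨ s' j = -1 := fun j => by
    by_cases hj : j ∈ A
    · rw [← hs' j hj]
      exact hs j hj
    · exact Or.inl (if_neg hj)
  have hpos := hpc.mul_inv_gram_mulVec_pos hsigns ⟨j, hj⟩
  rwa [← extend_coe A (_ *ᵥ _), ← gramSolve, ← gramSolve_congr hs', ← hs' j hj] at hpos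

theorem corr_mul_pathDir_pos {y : Fin n → ℝ} {l : ℝ} (hl : 0 < l) {j : Fin p}
    (hj : j ∈ equi X y l) : 0 < corr X y l j * pathDir X y l j := by
  have hsigns : ∀ i ∈ equi X y l, (l⁻¹ • corr X y l) i = 1 ∨ (l⁻¹ • corr X y l) i = -1 := by
    intro i hi
    rw [Pi.smul_apply, smul_eq_mul]
    rcases (abs_eq hl.le).1 (mem_equi.1 hi) with h | h <;> simp [h, hl.ne']
  have hpos := hpc.mul_gramSolve_pos hsigns hj
  rw [Pi.smul_apply, smul_eq_mul, mul_assoc] at hpos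
  exact pos_of_mul_pos_right hpos (inv_nonneg.2 hl.le)

variable (hX : LinearIndependent ℝ X.col) (y : Fin n → ℝ)
include hX

/-- All correlations in the equicorrelation set shrink at the same rate along `pathDir`, whose
entries there have the signs of the correlations; hence the optimality conditions persist. -/
theorem eventually_coef_sub_eq {l : ℝ} (hl : 0 < l) :
    ∀ᶠ δ in nhdsWithin (0 : ℝ) (Set.Ioi 0),
      coef X y (l - δ) = coef X y l + (δ / 2) • pathDir X y l := by
  set g : Fin p → ℝ := Xᵀ *ᵥ (X *ᵥ pathDir X y l) with hg
  filter_upwards [self_mem_nhdsWithin,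
    nhdsWithin_le_nhds (eventually_abs_corr_sub_lt hX y hl.le g),
    nhdsWithin_le_nhds (gt_mem_nhds hl)] with δ hδ₀ hδ hδl
  have hδ₀ : 0 < δ := hδ₀
  refine KKT.coef_eq hX (by linarith) fun j => ?_
  set b : ℝ := (coef X y l + (δ / 2) • pathDir X y l) j
  have hb' : b = coef X y l j + δ / 2 * pathDir X y l j := rfl
  rw [score_add_half_smul, ← hg, ← corr]
  by_cases hj : j ∈ equi X y l
  · have hgj : corr X y l j - δ * g j = (l - δ) / l * corr X y l j := by
      rw [hg, pathDir, transpose_mulVec_mulVec_gramSolve hX _ hj, Pi.smul_apply, smul_eq_mul]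
      field_simp
    have hcb : corr X y l j * b = l * |b| := by
      have hnonneg : 0 ≤ corr X y l j * b := by
        rw [hb', mul_add, corr_mul_coef hX y hl.le, mul_left_comm]
        have := hpc.corr_mul_pathDir_pos hl hj
        positivity
      rw [← abs_of_nonneg hnonneg, abs_mul, mem_equi.1 hj]
    rw [hgj, abs_mul, mem_equi.1 hj, mul_assoc, hcb, abs_of_nonneg
      (div_nonneg (sub_nonneg.2 hδl.le) hl.le), div_mul_cancel₀ _ hl.ne', ← mul_assoc,
      div_mul_cancel₀ _ hl.ne']
    exact ⟨le_rfl, rfl⟩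
  · have hzero : b = 0 := by
      have hinactive : coef X y l j = 0 := by
        simpa using mt (@active_subset_equi _ _ _ _ hX y hl.le j) hj
      rw [hb', hinactive, pathDir, gramSolve_of_notMem X _ hj, mul_zero, add_zero]
    rw [hzero]
    exact ⟨(hδ j hj).le, by simp⟩

theorem exists_mul_coef_lt {t l : ℝ} (hl : 0 < l) (htl : t < l) {j : Fin p}
    (hj : j ∈ equi X y l) :
    ∃ u ∈ Set.Ioo t l, corr X y l j * coef X y l j < corr X y l j * coef X y u j := by
  obtain ⟨δ, hδ, hδ₀, hδt⟩ := ((hpc.eventually_coef_sub_eq hX y hl).and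
    (Ioo_mem_nhdsGT (sub_pos.2 htl))).exists
  refine ⟨l - δ, ⟨by linarith, by linarith⟩, ?_⟩
  rw [hδ, Pi.add_apply, Pi.smul_apply, smul_eq_mul, mul_add, mul_left_comm]
  have := hpc.corr_mul_pathDir_pos hl hj
  exact lt_add_of_pos_right _ (by positivity)

/-- With `c` the correlation of `j` at `l`, the maximum of `c * coef j` over `[t, l]` is positive,
and by `exists_mul_coef_lt` it is not attained to the right of `t`. -/
theorem equi_subset_active {t l : ℝ} (ht : 0 ≤ t) (htl : t < l) :
    equi X y l ⊆ active X y t := by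
  intro j hj
  set c := corr X y l j
  have hcont : ContinuousOn (fun u => c * coef X y u j) (Set.Icc t l) :=
    continuousOn_const.mul ((continuousOn_pi.1 (continuousOn_coef hX y) j).mono
      fun u hu => ht.trans hu.1)
  obtain ⟨u, hu, hmax⟩ := isCompact_Icc.exists_isMaxOn ⟨t, Set.left_mem_Icc.2 htl.le⟩ hcont
  have hpos : 0 < c * coef X y u j := by
    obtain ⟨v, hv, hlt⟩ := hpc.exists_mul_coef_lt hX y (ht.trans_lt htl) htl hj
    rw [corr_mul_coef hX y (ht.trans htl.le)] at hlt
    have hl : 0 ≤ l := ht.trans htl.le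
    exact (lt_of_le_of_lt (by positivity) hlt).trans_le (hmax (Set.Ioo_subset_Icc_self hv))
  have hactive : j ∈ active X y u := mem_active.2 (right_ne_zero_of_mul hpos.ne')
  rcases hu.1.eq_or_lt with rfl | htu
  · exact hactive
  have hu₀ : 0 < u := ht.trans_lt htu
  obtain ⟨v, hv, hlt⟩ :=
    hpc.exists_mul_coef_lt hX y hu₀ htu (active_subset_equi hX y hu₀.le hactive)
  have hle : c * coef X y v j ≤ c * coef X y u j := hmax ⟨hv.1.le, hv.2.le.trans hu.2⟩
  have hcorr : 0 < corr X y u j * coef X y u j := by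
    rw [corr_mul_coef hX y hu₀.le]
    have := mem_active.1 hactive
    positivity
  have hsame : 0 < c * corr X y u j := by
    refine pos_of_mul_pos_left (b := coef X y u j ^ 2) ?_ (sq_nonneg _)
    linarith [mul_pos hpos hcorr]
  nlinarith [mul_pos hsame hsame]

end PositiveCone

theorem exists_mem_equi_notMem_active (hX : LinearIndependent ℝ X.col) (y : Fin n → ℝ) {l : ℝ}
    (hl : 0 < l) (h : l ∈ transitionPoints X y) : ∃ i ∈ equi X y l, i ∉ active X y l := by
  by_contra! hsub
  have hnonneg : ∀ᶠ l' in nhds l, 0 ≤ l' := (lt_mem_nhds hl).mono fun _ => le_of_lt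
  refine (h.resolve_left hl.ne').2 ?_
  filter_upwards [hnonneg,
    eventually_active_subset hX hl.le tendsto_const_nhds Filter.tendsto_id hnonneg,
    eventually_equi_subset hX hl.le tendsto_const_nhds Filter.tendsto_id hnonneg]
    with l' hl' hactive hequi
  exact ((active_subset_equi hX y hl').trans (hequi.trans hsub)).antisymm hactive

end

/-! ### The last step with `k` nonzero coefficients -/

section

variable {n p : ℕ} {X : Matrix (Fin n) (Fin p) ℝ}

/-- The smallest regularization parameter at which at most `k` coefficients are nonzero. -/
def kthKnot (X : Matrix (Fin n) (Fin p) ℝ) (k : ℕ) (y : Fin n → ℝ) : ℝ :=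
  sInf {l | 0 ≤ l ∧ (active X y l).card ≤ k}

theorem kthKnot_nonneg (X : Matrix (Fin n) (Fin p) ℝ) (k : ℕ) (y : Fin n → ℝ) :
    0 ≤ kthKnot X k y :=
  Real.sInf_nonneg fun _ hl => hl.1

theorem kthKnot_le {y : Fin n → ℝ} {k : ℕ} {l : ℝ} (hl : 0 ≤ l) (hk : (active X y l).card ≤ k) :
    kthKnot X k y ≤ l :=
  csInf_le ⟨0, fun _ h => h.1⟩ ⟨hl, hk⟩

theorem nonempty_setOf_card_active_le (hX : LinearIndependent ℝ X.col) (k : ℕ) (y : Fin n → ℝ) :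
    {l | 0 ≤ l ∧ (active X y l).card ≤ k}.Nonempty :=
  ⟨knot X y 0, knot_nonneg hX y 0, by simp [active_knot_zero hX y]⟩

theorem lastStep_mem_stepsWith {y : Fin n → ℝ} {k : ℕ} (h : (stepsWith X y k).Nonempty) :
    lastStep X y k ∈ stepsWith X y k :=
  Nat.sSup_mem h ⟨lastIndex X y, fun _ hm => hm.1⟩

namespace PositiveCone

variable (hpc : PositiveCone X) (hX : LinearIndependent ℝ X.col)
include hpc hX

theorem active_antitone (y : Fin n → ℝ) {t l : ℝ} (ht : 0 ≤ t) (htl : t ≤ l) :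
    active X y l ⊆ active X y t := by
  rcases htl.eq_or_lt with rfl | h
  · exact subset_rfl
  · exact (active_subset_equi hX y (ht.trans htl)).trans (hpc.equi_subset_active hX y ht h)

theorem le_kthKnot {y : Fin n → ℝ} {k : ℕ} {b : ℝ} (hk : k < (active X y b).card) :
    b ≤ kthKnot X k y := by
  refine le_csInf (nonempty_setOf_card_active_le hX k y) fun l hl => ?_
  by_contra! hlb
  exact (hk.trans_le (Finset.card_le_card (hpc.active_antitone hX y hl.1 hlb.le))).not_ge hl.2

theorem card_equi_le {y : Fin n → ℝ} {k : ℕ} {b : ℝ} (hb : kthKnot X k y < b) :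
    (equi X y b).card ≤ k := by
  obtain ⟨t, ⟨ht, htk⟩, htb⟩ := exists_lt_of_csInf_lt (nonempty_setOf_card_active_le hX k y) hb
  exact (Finset.card_le_card (hpc.equi_subset_active hX y ht htb)).trans htk

theorem continuous_kthKnot (k : ℕ) : Continuous (kthKnot X k) := by
  refine continuous_iff_continuousAt.2 fun y => tendsto_order.2 ⟨fun a ha => ?_, fun a ha => ?_⟩
  · rcases lt_or_ge a 0 with ha₀ | ha₀
    · exact .of_forall fun y' => ha₀.trans_le (kthKnot_nonneg X k y')
    obtain ⟨b, hab, hb⟩ := exists_between ha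
    have hb₀ : 0 ≤ b := ha₀.trans hab.le
    have hk : k < (active X y b).card := by
      by_contra! hk
      exact (kthKnot_le hb₀ hk).not_gt hb
    filter_upwards [eventually_active_subset hX hb₀ Filter.tendsto_id tendsto_const_nhds
      (.of_forall fun _ => hb₀)] with y' hsub
    exact hab.trans_le (hpc.le_kthKnot hX (hk.trans_le (Finset.card_le_card hsub)))
  · obtain ⟨b, hb, hba⟩ := exists_between ha
    have hb₀ : 0 ≤ b := (kthKnot_nonneg X k y).trans hb.le
    filter_upwards [eventually_equi_subset hX hb₀ Filter.tendsto_id tendsto_const_nhds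
      (.of_forall fun _ => hb₀)] with y' hsub
    refine (kthKnot_le hb₀ ?_).trans_lt hba
    exact (Finset.card_le_card ((active_subset_equi hX y' hb₀).trans hsub)).trans
      (hpc.card_equi_le hX hb)

theorem continuous_fit_kthKnot (k : ℕ) : Continuous fun y => fit X y (kthKnot X k y) := by
  refine continuous_const.matrix_mulVec (continuous_iff_continuousAt.2 fun y => ?_)
  exact tendsto_coef hX (kthKnot_nonneg X k y) Filter.tendsto_id
    ((hpc.continuous_kthKnot hX k).tendsto y) (.of_forall (kthKnot_nonneg X k))

/-- At a positive transition point some predictor of the equicorrelation set is inactive, and it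
is active at all smaller values of the regularization parameter. -/
theorem knot_lastStep {y : Fin n → ℝ} {k : ℕ} (h : (stepsWith X y k).Nonempty) :
    knot X y (lastStep X y k) = kthKnot X k y := by
  obtain ⟨-, hk⟩ := lastStep_mem_stepsWith h
  set l := knot X y (lastStep X y k)
  refine le_antisymm (le_csInf (nonempty_setOf_card_active_le hX k y) fun t ht => ?_)
    (kthKnot_le (knot_nonneg hX y _) hk.le)
  by_contra! htl
  obtain ⟨i, hi, hi'⟩ := exists_mem_equi_notMem_active hX y (ht.1.trans_lt htl)
    (knot_mem_transitionPoints hX y _)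
  have hssub : active X y l ⊂ active X y t :=
    (Finset.ssubset_iff_of_subset (hpc.active_antitone hX y ht.1 htl.le)).2
      ⟨i, hpc.equi_subset_active hX y ht.1 htl hi, hi'⟩
  exact (hk ▸ Finset.card_lt_card hssub).not_ge ht.2

end PositiveCone

/-- The matrices of trace `k` that can map a response to its fit at the last step with `k` nonzero
coefficients. The last step is either at a positive transition point or at `0`, where the fit is
that of least squares. -/
def selectors (X : Matrix (Fin n) (Fin p) ℝ) (k : ℕ) : Set (Matrix (Fin n) (Fin n) ℝ) :=
  {S | ∃ A : Finset (Fin p), A.card = k ∧ (S = hat X A ∨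
    ∃ (s : Fin p → SignType) (e : SignType) (i : Fin p), S = selector X A (fun j => s j) e i)}

theorem finite_selectors (X : Matrix (Fin n) (Fin p) ℝ) (k : ℕ) : (selectors X k).Finite := by
  refine ((Set.finite_range fun A => hat X A).union (Set.finite_range
    fun q : Finset (Fin p) × (Fin p → SignType) × SignType × Fin p =>
      selector X q.1 (fun j => q.2.1 j) q.2.2.1 q.2.2.2)).subset ?_
  rintro S ⟨A, -, rfl | ⟨s, e, i, rfl⟩⟩
  · exact Or.inl ⟨A, rfl⟩
  · exact Or.inr ⟨(A, s, e, i), rfl⟩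

variable (hX : LinearIndependent ℝ X.col)
include hX

theorem trace_of_mem_selectors {k : ℕ} {S : Matrix (Fin n) (Fin n) ℝ} (hS : S ∈ selectors X k) :
    S.trace = k := by
  obtain ⟨A, rfl, rfl | ⟨s, e, i, rfl⟩⟩ := hS
  · exact trace_hat hX A
  · exact trace_selector hX A _ _ i

theorem Generic.exists_fit_kthKnot_eq (hpc : PositiveCone X) {y : Fin n → ℝ} (hy : Generic X y)
    {k : ℕ} (hk : k ≤ p) : ∃ S ∈ selectors X k, fit X y (kthKnot X k y) = S *ᵥ y := by
  have hne := hy.stepsWith_nonempty hX hk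
  obtain ⟨-, hcard⟩ := lastStep_mem_stepsWith hne
  have hmem := knot_mem_transitionPoints hX y (lastStep X y k)
  rw [hpc.knot_lastStep hX hne] at hcard hmem
  set l := kthKnot X k y
  rcases (kthKnot_nonneg X k y).eq_or_lt with hl | hl
  · have hl_half : l / 2 = 0 := div_eq_zero_iff.2 (Or.inl hl.symm)
    refine ⟨_, ⟨active X y l, hcard, Or.inl rfl⟩, ?_⟩
    rw [fit_eq_hat_mulVec_sub hX y hl.le, hl_half, zero_smul, sub_zero]
  · obtain ⟨i, hi, hi'⟩ := exists_mem_equi_notMem_active hX y hl hmem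
    have hcorr : corr X y l i = l * SignType.sign (corr X y l i) := by
      conv_lhs => rw [← abs_mul_sign (corr X y l i), mem_equi.1 hi]
    have hs : sgn X y l = fun j => (SignType.sign (coef X y l j) : ℝ) :=
      funext fun j => real_sign_eq_coe_sign _
    refine ⟨_, ⟨active X y l, hcard, Or.inr
      ⟨fun j => SignType.sign (coef X y l j), SignType.sign (corr X y l i), i, rfl⟩⟩, ?_⟩
    rw [← hs]
    exact fit_eq_selector_mulVec hX y hl.le hcorr
      (right_ne_zero_of_mul (hy.half_mul_denom_ne_zero hX hl.le hi' hcorr))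

end

/-! ### Degrees of freedom -/

section

variable {n p : ℕ} {μ : Fin n → ℝ} {v : ℝ≥0}

theorem isOpenPosMeasure_normalLaw (hv : v ≠ 0) : (normalLaw μ v).IsOpenPosMeasure := by
  have := fun i => (gaussianReal_absolutelyContinuous' (μ i) hv).isOpenPosMeasure
  unfold normalLaw
  infer_instance

theorem ae_normalLaw_dotProduct_ne_zero (hv : v ≠ 0) {a : Fin n → ℝ} (ha : a ≠ 0) :
    ∀ᵐ y ∂normalLaw μ v, a ⬝ᵥ y ≠ 0 := by
  have := fun i => nullSingletonClass_gaussianReal (μ := μ i) hv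
  exact ae_dotProduct_ne_zero _ ha

theorem ae_normalLaw_injOn_mulVec (hv : v ≠ 0) {F : Set (Matrix (Fin n) (Fin n) ℝ)}
    (hF : F.Finite) : ∀ᵐ y ∂normalLaw μ v, F.InjOn (· *ᵥ y) := by
  refine (ae_ball_iff hF.countable).2 fun S _ => (ae_ball_iff hF.countable).2 fun T _ => ?_
  by_cases hST : S = T
  · exact .of_forall fun _ _ => hST
  obtain ⟨i, hi⟩ := Function.ne_iff.1 hST
  filter_upwards [ae_normalLaw_dotProduct_ne_zero hv (sub_ne_zero.2 hi)] with y hy hSTy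
  rw [sub_dotProduct] at hy
  exact absurd (sub_eq_zero.2 (congrFun hSTy i)) hy

theorem ae_generic (X : Matrix (Fin n) (Fin p) ℝ) (μ : Fin n → ℝ) (hv : v ≠ 0) :
    ∀ᵐ y ∂normalLaw μ v, Generic X y :=
  (Finset.eventually_all _).2 fun _ ha =>
    ae_normalLaw_dotProduct_ne_zero hv (ne_zero_of_mem_normals ha)

theorem dense_generic (X : Matrix (Fin n) (Fin p) ℝ) : Dense {y | Generic X y} := by
  have : (normalLaw (0 : Fin n → ℝ) 1).IsOpenPosMeasure := isOpenPosMeasure_normalLaw one_ne_zero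
  exact Measure.dense_of_ae (ae_generic X 0 one_ne_zero)

section DegreesOfFreedom

variable {δ : (Fin n → ℝ) → Fin n → ℝ}

theorem df_congr_ae {δ' : (Fin n → ℝ) → Fin n → ℝ} (h : δ =ᵐ[normalLaw μ v] δ') :
    df μ v δ = df μ v δ' := by
  refine Finset.sum_congr rfl fun i _ => ?_
  have hi : (fun y => δ y i) =ᵐ[normalLaw μ v] fun y => δ' y i :=
    h.mono fun y hy => congrFun hy i
  rw [covariance, covariance, integral_congr_ae hi]
  exact congrArg (· / _) (integral_congr_ae (hi.mono fun y hy => by simp only [hy]))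

theorem df_eq_integral_sum_lineDeriv {K : ℝ≥0} (hδ : LipschitzWith K δ) (hv : v ≠ 0) :
    df μ v δ = ∫ y, ∑ i, lineDeriv ℝ (fun y => δ y i) y (Pi.single i 1) ∂normalLaw μ v := by
  have hδi : ∀ i, LipschitzWith K fun y => δ y i := fun i =>
    one_mul K ▸ (LipschitzWith.eval i).comp hδ
  unfold normalLaw df
  rw [integral_finsetSum _ fun i _ => integrable_lineDeriv (hδi i) _]
  refine Finset.sum_congr rfl fun i _ => ?_
  rw [normalLaw, covariance_pi_gaussianReal (hδi i),
    mul_div_cancel_left₀ _ (NNReal.coe_ne_zero.2 hv)]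

variable (hδ : Continuous δ) {F : Set (Matrix (Fin n) (Fin n) ℝ)} (hF : F.Finite)
  (hδF : ∀ y, ∃ S ∈ F, δ y = S *ᵥ y)
include hδ hF hδF

theorem exists_lipschitzWith_of_forall_exists_mulVec_eq : ∃ K, LipschitzWith K δ := by
  refine exists_lipschitzWith_of_forall_exists_mem_eq
    (F := (fun S => S.mulVecLin.toContinuousLinearMap) '' F) hδ (hF.image _) fun y => ?_
  obtain ⟨S, hS, hδS⟩ := hδF y
  exact ⟨_, ⟨S, hS, rfl⟩, hδS⟩

theorem exists_lineDeriv_eq_diag {y : Fin n → ℝ} (hy : F.InjOn (· *ᵥ y)) :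
    ∃ S ∈ F, ∀ i, lineDeriv ℝ (fun y => δ y i) y (Pi.single i 1) = S i i := by
  obtain ⟨S, hS, hδS⟩ := hδF y
  have hloc : δ =ᶠ[nhds y] fun z => S *ᵥ z := by
    refine eventuallyEq_of_forall_exists_mem_eq (F := (fun S z => S *ᵥ z) '' F) hδ (hF.image _)
      ?_ (fun z => ?_) ?_
    · rintro _ ⟨T, -, rfl⟩
      exact continuous_const.matrix_mulVec continuous_id
    · obtain ⟨T, hT, hδT⟩ := hδF z
      exact ⟨_, ⟨T, hT, rfl⟩, hδT⟩
    · rintro _ ⟨T, hT, rfl⟩ hδT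
      rw [hy hT hS (hδT.symm.trans hδS)]
  refine ⟨S, hS, fun i => ?_⟩
  exact (hloc.fun_comp (· i)).lineDeriv_eq.trans (lineDeriv_mulVec_apply S y i i)

theorem df_eq_of_forall_trace_eq {k : ℝ} (hk : ∀ S ∈ F, S.trace = k) (hv : v ≠ 0) :
    df μ v δ = k := by
  obtain ⟨K, hK⟩ := exists_lipschitzWith_of_forall_exists_mulVec_eq hδ hF hδF
  have hdiv : ∀ᵐ y ∂normalLaw μ v,
      ∑ i, lineDeriv ℝ (fun y => δ y i) y (Pi.single i 1) = k := by
    filter_upwards [ae_normalLaw_injOn_mulVec hv hF] with y hy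
    obtain ⟨S, hS, hSd⟩ := exists_lineDeriv_eq_diag hδ hF hδF hy
    rw [← hk S hS]
    exact Finset.sum_congr rfl fun i _ => hSd i
  have : IsProbabilityMeasure (normalLaw μ v) := by unfold normalLaw; infer_instance
  rw [df_eq_integral_sum_lineDeriv hK hv, integral_congr_ae hdiv, integral_const, probReal_univ,
    one_smul]

theorem memLp_of_forall_exists_mulVec_eq : MemLp δ 2 (normalLaw μ v) := by
  obtain ⟨K, hK⟩ := exists_lipschitzWith_of_forall_exists_mulVec_eq hδ hF hδF
  unfold normalLaw
  exact memLp_of_lipschitzWith memLp_id_pi_gaussianReal hK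

end DegreesOfFreedom

section LastFit

variable {X : Matrix (Fin n) (Fin p) ℝ} (hX : LinearIndependent ℝ X.col) (hpc : PositiveCone X)
  {k : ℕ} (hk : k ≤ p)
include hX hpc hk

theorem PositiveCone.lastFit_ae_eq (hv : v ≠ 0) :
    lastFit X k =ᵐ[normalLaw μ v] fun y => fit X y (kthKnot X k y) := by
  filter_upwards [ae_generic X μ hv] with y hy
  rw [lastFit, hpc.knot_lastStep hX (hy.stepsWith_nonempty hX hk)]

theorem PositiveCone.exists_fit_kthKnot_eq (y : Fin n → ℝ) :
    ∃ S ∈ selectors X k, fit X y (kthKnot X k y) = S *ᵥ y := by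
  have hgen : ∀ z ∈ {z | Generic X z},
      ∃ f ∈ (fun S z => S *ᵥ z) '' selectors X k, fit X z (kthKnot X k z) = f z := by
    intro z hz
    obtain ⟨S, hS, hfit⟩ := Generic.exists_fit_kthKnot_eq hX hpc hz hk
    exact ⟨_, ⟨S, hS, rfl⟩, hfit⟩
  obtain ⟨_, ⟨S, hS, rfl⟩, hfit⟩ := exists_mem_eq_of_dense (hpc.continuous_fit_kthKnot hX k)
    ((finite_selectors X k).image _)
    (Set.forall_mem_image.2 fun S _ => continuous_const.matrix_mulVec continuous_id)
    (dense_generic X) hgen y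
  exact ⟨S, hS, hfit⟩

theorem PositiveCone.memLp_lastFit (hv : v ≠ 0) (i : Fin n) :
    MemLp (fun y => lastFit X k y i) 2 (normalLaw μ v) := by
  have hfit := memLp_of_forall_exists_mulVec_eq (μ := μ) (v := v)
    (hpc.continuous_fit_kthKnot hX k) (finite_selectors X k) (hpc.exists_fit_kthKnot_eq hX hk)
  exact ((memLp_congr_ae (hpc.lastFit_ae_eq hX hk hv)).2 hfit).eval i

theorem PositiveCone.df_lastFit (hv : v ≠ 0) : df μ v (lastFit X k) = k :=
  (df_congr_ae (hpc.lastFit_ae_eq hX hk hv)).trans <|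
    df_eq_of_forall_trace_eq (hpc.continuous_fit_kthKnot hX k) (finite_selectors X k)
      (hpc.exists_fit_kthKnot_eq hX hk) (fun _ hS => trace_of_mem_selectors hX hS) hv

end LastFit

end

end Lasso

end

theorem mainTheorem4 {n p : ℕ} (X : Matrix (Fin n) (Fin p) ℝ)
    (hX : LinearIndependent ℝ X.col) :
    -- the lasso path and its transition points are well defined
    ((∀ (y : Fin n → ℝ) (l : ℝ), 0 ≤ l →
        ∃! β, ∀ b, Lasso.objective X y l β ≤ Lasso.objective X y l b) ∧
      ∀ y : Fin n → ℝ,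
        (Lasso.transitionPoints X y).Finite ∧
        (∀ l, Lasso.knot X y 0 < l → Lasso.coef X y l = 0) ∧
        ∀ m < Lasso.lastIndex X y,
          ∀ l ∈ Set.Ioo (Lasso.knot X y (m + 1)) (Lasso.knot X y m),
            Lasso.active X y l = Lasso.intervalActive X y m ∧
            Lasso.sgn X y l = Lasso.intervalSgn X y m) ∧
    -- one at a time, outside finitely many hyperplanes
    (∃ M : Finset (Fin n → ℝ), (∀ a ∈ M, a ≠ 0) ∧
      ∀ y : Fin n → ℝ, (∀ a ∈ M, a ⬝ᵥ y ≠ 0) →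
        ∀ m ≤ Lasso.lastIndex X y,
          (Lasso.joining X y m).card ≤ 1 ∧ (Lasso.leaving X y m).card ≤ 1 ∧
          ∀ i ∈ Lasso.joining X y m, Lasso.stepDenom X y m i ≠ 0) ∧
    -- the fit at a transition point, and the trace
    (∀ (y : Fin n → ℝ) (m : ℕ), m ≤ Lasso.lastIndex X y → 0 < Lasso.knot X y m →
      ∀ i ∈ Lasso.joining X y m,
        (Lasso.stepDenom X y m i ≠ 0 →
          Lasso.fit X y (Lasso.knot X y m) = Lasso.stepMatrix X y m i *ᵥ y) ∧
        (Lasso.stepMatrix X y m i).trace = ((Lasso.active X y (Lasso.knot X y m)).card : ℝ)) ∧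
    -- the last step with `k` nonzero predictors exists almost surely
    (∀ (μ : Fin n → ℝ) (v : ℝ≥0), 0 < v → ∀ k ≤ p,
      ∀ᵐ y ∂(Lasso.normalLaw μ v), (Lasso.stepsWith X y k).Nonempty) ∧
    -- the degrees of freedom under the positive cone condition
    (Lasso.PositiveCone X →
      ∀ (μ : Fin n → ℝ) (v : ℝ≥0), 0 < v → ∀ k ≤ p,
        (∀ i, MemLp (fun y => Lasso.lastFit X k y i) 2 (Lasso.normalLaw μ v)) ∧
        Lasso.df μ v (Lasso.lastFit X k) = (k : ℝ)) := by
  refine ⟨⟨fun y l hl => Lasso.existsUnique_forall_objective_le hX y hl, fun y =>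
    ⟨Lasso.finite_transitionPoints hX y, fun l hl => Lasso.coef_eq_zero_of_knot_zero_lt hX y hl,
      fun m _ l hl => ⟨Lasso.active_eq_intervalActive hX y hl,
        Lasso.sgn_eq_intervalSgn hX y hl⟩⟩⟩, ?_, ?_, ?_, ?_⟩
  · refine ⟨Lasso.normals X, fun a ha => Lasso.ne_zero_of_mem_normals ha, fun y hy m _ => ?_⟩
    have hgen : Lasso.Generic X y := hy
    exact ⟨hgen.card_joining_le_one hX m, hgen.card_leaving_le_one hX m,
      fun i hi => hgen.stepDenom_ne_zero hX hi⟩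
  · intro y m _ _ i hi
    rw [Lasso.stepDenom_eq_denom, Lasso.stepMatrix_eq_selector]
    exact ⟨Lasso.fit_eq_selector_mulVec hX y (Lasso.knot_nonneg hX y m)
      (Lasso.corr_of_mem_joining hX hi), Lasso.trace_selector hX _ _ _ i⟩
  · intro μ v hv k hk
    filter_upwards [Lasso.ae_generic X μ hv.ne'] with y hy
    exact hy.stepsWith_nonempty hX hk
  · intro hpc μ v hv k hk
    exact ⟨hpc.memLp_lastFit hX hk hv.ne', hpc.df_lastFit hX hk hv.ne'⟩
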